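/- **Setting.** Let $n\ge 1$, let $y_1,\dots,y_n$ be observations with likelihood $p(y\mid f)$, $f\in\mathbb R$, and let $r=(m,V)$ with $m\in\mathbb R^k$ and $V$ a symmetric $k\times k$ matrix; the parameter space carries the Euclidean norm of the vectorized pair $(m,V)$. For given vectors $a_{i,1},a_{i,2}\in\mathbb R^k$ and scalars $b_{i,1},b_{i,2}$ put $\mu_i(r)=a_{i,1}^\top m+b_{i,1}$, $v_i(r)=a_{i,2}^\top Va_{i,2}+b_{i,2}$ and $q(f_i\mid r)=\mathcal N(\mu_i(r),v_i(r))$. Let $\beta\ge 0$, let $\mathcal N(m_0,K_0)$ be a prior with $K_0$ positive definite, and let $$h(r)=-\frac1n\sum_{i=1}^n\log \mathbb E_{q(f_i\mid r)}[p(y_i\mid f_i)]+\frac{\beta}{n}\,d_{KL}\big(\mathcal N(m,V)\,\|\,\mathcal N(m_0,K_0)\big)$$ be the log-loss DLM objective. Let $\phi_i(r,\epsilon),\phi_i'(r,\epsilon),\phi_i''(r,\epsilon)$ be the value, first and second derivative of $f\mapsto p(y_i\mid f)$ at $f=\sqrt{v_i(r)}\,\epsilon+\mu_i(r)$; expectations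 $\mathbb E$ of these are over $\epsilon\sim\mathcal N(0,1)$. For samples $\epsilon^{(1)},\dots,\epsilon^{(L)}$ the biased Monte Carlo (bMC) direction is $$d=\frac1n\sum_{i=1}^n\left(\frac{\sum_{\ell}\phi_i'(r,\epsilon^{(\ell)})}{\sum_{\ell}\phi_i(r,\epsilon^{(\ell)})}\,a_{i,1},\ \frac{\sum_{\ell}\phi_i''(r,\epsilon^{(\ell)})}{\sum_{\ell}\phi_i(r,\epsilon^{(\ell)})}\,\frac{a_{i,2}a_{i,2}^\top}{2}\right)-\frac{\beta}{n}\nabla_r d_{KL},$$ where the samples may be shared between examples or may depend on $i$. bMC iterates $r_{t+1}=r_t+\gamma_td_t$, where $r_t$ and the sample size $L_t$ depend only on the past, and $d_t$ is the bMC direction at $r_t$ with $L_t$ samples which, for each $i$, are i.i.d. $\mathcal N(0,1)$ and independent of the past. **Assumptions.** For each $i$, $f\mapsto p(y_i\mid f)$ is twice differentiable, with $0\le\phi_i\le B$, $b'\le\phi_i'\le B'$ and $b''\le\phi_i''\le B''$ for finite constants. The step sizes satisfy $\gamma_t>0$, $\sum_t\gamma_t=\infty$, $\sum_t\gamma_t^2<\infty$;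 $\delta_t>0$ and $\sum_t\delta_t=\delta$. There are constants $\zeta,\lambda>0$ such that almost surely all iterates lie in the set $S$ of those $r$ for which, for all $i$, $\mathbb E_{q(f_i\mid r)}[p(y_i\mid f_i)]\ge\zeta$ and $v_i(r)\ge\lambda$, and, in case $\beta>0$, $V\succeq\lambda I$. Almost surely, for all $t$ and $i$, $$L_t>\frac{\log(6n/\delta_t)}{2\gamma_t^2}\,M,\qquad M=\max\left\{\frac{B^2}{|\mathbb E\phi_i(r_t,\epsilon)|^2},\ \frac{(B'-b')^2}{P^2},\ \frac{(B''-b'')^2}{Q^2}\right\},$$ where $P=|\mathbb E\phi_i'(r_t,\epsilon)|$ if this is nonzero and $P=1$ otherwise, and $Q=|\mathbb E\phi_i''(r_t,\epsilon)|$ if this is nonzero and $Q=1$ otherwise. **Conclusion.** There are (non-random) positive constants $c_1,c_2,c_3,c_4$ and a constant $\Lambda$ such that with probability at least $1-\delta$ the bMC iterates satisfy the following conditions for convergence of a gradient method with errors: $h$ is differentiable at every point of $S$ and $\nabla h$ is $\Lambda$-Lipschitz on $S$, which contains all $r_t$; $\sum_t\gamma_t=\infty$ and $\sum_t\gamma_t^2<\infty$;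 and $r_{t+1}=r_t+\gamma_td_t$ with $d_t=s_t+w_t$ such that for all $t$ $$c_1\|\nabla h(r_t)\|^2\le-\nabla h(r_t)^\top s_t,\qquad \|s_t\|\le c_2\|\nabla h(r_t)\|,\qquad \|w_t\|\le\gamma_t\,(c_3+c_4\|\nabla h(r_t)\|);$$ and, on the same event, $h(r_t)$ converges to a finite limit and $\nabla h(r_t)\to0$. -/

import Mathlib

open MeasureTheory ProbabilityTheory Filter Topology
open scoped NNReal ENNReal Matrix Gradient

noncomputable section

namespace DLM

/-- Symmetric `k × k` real matrices, vectorized: a subspace of `ℝ^(k × k)` with the Euclidean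
(Frobenius) inner product. -/
def SymMat (k : ℕ) : Submodule ℝ (EuclideanSpace ℝ (Fin k × Fin k)) where
  carrier := {V | ∀ i j, V (i, j) = V (j, i)}
  add_mem' := by
    intro a b ha hb i j
    simp [ha i j, hb i j]
  zero_mem' := by
    intro i j
    simp
  smul_mem' := by
    intro c a ha i j
    simp [ha i j]

/-- The parameter space of pairs `r = (m, V)`, with the Euclidean norm of the concatenation of `m`
and the vectorization of `V`. -/
abbrev Param (k : ℕ) : Type := WithLp 2 (EuclideanSpace ℝ (Fin k) × SymMat k)

/-- The mean parameter `m` of `r = (m, V)`. -/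
def Param.m {k : ℕ} (r : Param k) : EuclideanSpace ℝ (Fin k) := r.fst

/-- The covariance parameter `V` of `r = (m, V)`, as a matrix. -/
def Param.V {k : ℕ} (r : Param k) : Matrix (Fin k) (Fin k) ℝ :=
  Matrix.of fun i j => (r.snd : EuclideanSpace ℝ (Fin k × Fin k)) (i, j)

/-- The vectorization of the rank one matrix `a aᵀ`. -/
def outer {k : ℕ} (a : EuclideanSpace ℝ (Fin k)) : SymMat k :=
  ⟨WithLp.toLp 2 fun ij => a ij.1 * a ij.2, fun i j => by simp [mul_comm]⟩

/-- The data of the learning problem: `n` observations `y i`, the likelihood `p(y | f)`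
(written `p y f`), the vectors and scalars that determine the marginals
`q(f_i | r) = N(a_{i,1}ᵀ m + b_{i,1}, a_{i,2}ᵀ V a_{i,2} + b_{i,2})`, the Gaussian prior
`N(m₀, K₀)`, and the regularization parameter `β`. -/
structure Model (Y : Type*) (n k : ℕ) where
  p : Y → ℝ → ℝ
  y : Fin n → Y
  a₁ : Fin n → EuclideanSpace ℝ (Fin k)
  b₁ : Fin n → ℝ
  a₂ : Fin n → EuclideanSpace ℝ (Fin k)
  b₂ : Fin n → ℝ
  m₀ : EuclideanSpace ℝ (Fin k)
  K₀ : Matrix (Fin k) (Fin k) ℝ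
  β : ℝ

namespace Model

variable {Y : Type*} {n k : ℕ} (D : Model Y n k)

/-- The mean `a_{i,1}ᵀ m + b_{i,1}` of `q(f_i | r)`. -/
def mean (i : Fin n) (r : Param k) : ℝ := (D.a₁ i).ofLp ⬝ᵥ r.m.ofLp + D.b₁ i

/-- The variance `a_{i,2}ᵀ V a_{i,2} + b_{i,2}` of `q(f_i | r)`. -/
def var (i : Fin n) (r : Param k) : ℝ := (D.a₂ i).ofLp ⬝ᵥ (r.V *ᵥ (D.a₂ i).ofLp) + D.b₂ i

/-- The marginal `q(f_i | r)`. -/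
def q (i : Fin n) (r : Param k) : Measure ℝ := gaussianReal (D.mean i r) (D.var i r).toNNReal

/-- The predictive expectation `E_{q(f_i | r)} p(y_i | f_i)`. -/
def predictive (i : Fin n) (r : Param k) : ℝ := ∫ f, D.p (D.y i) f ∂(D.q i r)

/-- `d_KL(q, p)` for `q = N(m, V)` and the prior `p = N(m₀, K₀)`. -/
def kl (r : Param k) : ℝ :=
  (InformationTheory.klDiv (multivariateGaussian r.m r.V)
    (multivariateGaussian D.m₀ D.K₀)).toReal

/-- The (scaled) log-loss DLM objective. -/
def objective (r : Param k) : ℝ :=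
  -(1 / (n : ℝ)) * (∑ i, Real.log (D.predictive i r)) + D.β / n * D.kl r

/-- The reparameterization `g_i(r, ε)`. -/
def g (i : Fin n) (r : Param k) (ε : ℝ) : ℝ := √(D.var i r) * ε + D.mean i r

/-- `φ_i(r, ε) = p(y_i | f_i = g_i(r, ε))`. -/
def φ (i : Fin n) (r : Param k) (ε : ℝ) : ℝ := D.p (D.y i) (D.g i r ε)

/-- `φ_i'(r, ε)`, the derivative of `p(y_i | f_i)` in `f_i` at `g_i(r, ε)`. -/
def φ' (i : Fin n) (r : Param k) (ε : ℝ) : ℝ := deriv (D.p (D.y i)) (D.g i r ε)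

/-- `φ_i''(r, ε)`, the second derivative of `p(y_i | f_i)` in `f_i` at `g_i(r, ε)`. -/
def φ'' (i : Fin n) (r : Param k) (ε : ℝ) : ℝ := deriv (deriv (D.p (D.y i))) (D.g i r ε)

/-- The likelihood and its first two derivatives in `f` exist and are bounded. -/
structure DerivativeBounds (B b' B' b'' B'' : ℝ) : Prop where
  differentiable : ∀ i, Differentiable ℝ (D.p (D.y i))
  differentiable_deriv : ∀ i, Differentiable ℝ (deriv (D.p (D.y i)))
  bound : ∀ i f, 0 ≤ D.p (D.y i) f ∧ D.p (D.y i) f ≤ B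
  bound' : ∀ i f, b' ≤ deriv (D.p (D.y i)) f ∧ deriv (D.p (D.y i)) f ≤ B'
  bound'' : ∀ i f, b'' ≤ deriv (deriv (D.p (D.y i))) f ∧ deriv (deriv (D.p (D.y i))) f ≤ B''

/-- The bMC direction for example `i` from the samples `ε 0, …, ε (L - 1)`: the pair
`(d_{i,m}, d_{i,V})`. -/
def exampleDirection (i : Fin n) (L : ℕ) (ε : ℕ → ℝ) (r : Param k) : Param k :=
  WithLp.toLp 2
    (((∑ l ∈ Finset.range L, D.φ' i r (ε l)) / ∑ l ∈ Finset.range L, D.φ i r (ε l)) • D.a₁ i,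
     ((∑ l ∈ Finset.range L, D.φ'' i r (ε l)) / ∑ l ∈ Finset.range L, D.φ i r (ε l)) •
        ((1 / 2 : ℝ) • outer (D.a₂ i)))

/-- The bMC step direction for the whole objective: Monte Carlo estimates for the loss terms and
the exact gradient of the KL term. -/
def bmcDirection (L : ℕ) (ε : Fin n → ℕ → ℝ) (r : Param k) : Param k :=
  (1 / (n : ℝ)) • (∑ i, D.exampleDirection i L (ε i) r) - (D.β / n) • ∇ D.kl r

/-- `|x|` if `x ≠ 0`, and `1` otherwise. -/
def absOrOne (x : ℝ) : ℝ := if x ≠ 0 then |x| else 1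

/-- The factor `M` of the sample size condition for example `i` at `r`; the expectations are over
`ε ∼ N(0, 1)`. -/
def sampleFactor (B b' B' b'' B'' : ℝ) (i : Fin n) (r : Param k) : ℝ :=
  max (B ^ 2 / |∫ ε, D.φ i r ε ∂(gaussianReal 0 1)| ^ 2)
    (max ((B' - b') ^ 2 / absOrOne (∫ ε, D.φ' i r ε ∂(gaussianReal 0 1)) ^ 2)
      ((B'' - b'') ^ 2 / absOrOne (∫ ε, D.φ'' i r ε ∂(gaussianReal 0 1)) ^ 2))

/-- The parameters at which all predictive expectations are at least `ζ`, all variances of the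
marginals `q(f_i | r)` are at least `lam` and, if the KL term is present, `V ⪰ lam • I`. -/
def domain (ζ lam : ℝ) : Set (Param k) :=
  {r | (∀ i, ζ ≤ D.predictive i r) ∧ (∀ i, lam ≤ D.var i r) ∧
    (0 < D.β → (r.V - lam • (1 : Matrix (Fin k) (Fin k) ℝ)).PosSemidef)}

end Model

/-- The conditions for convergence of the gradient method with errors
`r_{t+1} = r_t + γ_t d_t`, `d_t = s_t + w_t`, for the objective `h` on the set `S` of parameters
and with the constants `c₁, c₂, c₃, c₄` and Lipschitz constant `Λ`. -/
structure GradientMethodWithErrors {E : Type*} [NormedAddCommGroup E] [InnerProductSpace ℝ E]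
    [CompleteSpace E] (h : E → ℝ) (S : Set E) (γ : ℕ → ℝ) (r d : ℕ → E)
    (c₁ c₂ c₃ c₄ : ℝ) (Λ : ℝ≥0) : Prop where
  mem : ∀ t, r t ∈ S
  step : ∀ t, r (t + 1) = r t + γ t • d t
  decomposition : ∃ s w : ℕ → E, ∀ t, d t = s t + w t ∧
    c₁ * ‖∇ h (r t)‖ ^ 2 ≤ -inner ℝ (∇ h (r t)) (s t) ∧
    ‖s t‖ ≤ c₂ * ‖∇ h (r t)‖ ∧
    ‖w t‖ ≤ γ t * (c₃ + c₄ * ‖∇ h (r t)‖)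
  differentiable : ∀ x ∈ S, DifferentiableAt ℝ h x
  lipschitz : LipschitzOnWith Λ (∇ h) S
  summable_sq : Summable fun t => γ t ^ 2
  sum_tendsto : Tendsto (fun T => ∑ t ∈ Finset.range T, γ t) atTop atTop

/-- A run of bMC with step sizes `γ`, adapted sample sizes `L` and samples `ε t i l`. The iterate
`r t` and the sample size `L t` depend on the past only, and for each example `i` the samples of
step `t` are i.i.d. standard normal and independent of the past. -/
structure IsBMCRun {Y : Type*} {n k : ℕ} (D : Model Y n k) {Ω : Type*} {mΩ : MeasurableSpace Ω}
    (P : Measure Ω) (ℱ : Filtration ℕ mΩ) (γ : ℕ → ℝ) (L : ℕ → Ω → ℕ)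
    (ε : ℕ → Fin n → ℕ → Ω → ℝ) (r : ℕ → Ω → Param k) : Prop where
  adapted : StronglyAdapted ℱ r
  adapted_size : Adapted ℱ L
  measurable_sample : ∀ t i l, Measurable (ε t i l)
  law : ∀ t i l, HasLaw (ε t i l) (gaussianReal 0 1) P
  iIndep : ∀ t i, iIndepFun (fun l => ε t i l) P
  indep_past : ∀ t i, Indep (MeasurableSpace.comap (fun ω l => ε t i l ω) MeasurableSpace.pi)
    (ℱ t) P
  step : ∀ t ω, r (t + 1) ω =
    r t ω + γ t • D.bmcDirection (L t ω) (fun i l => ε t i l ω) (r t ω)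

end DLM

end

noncomputable section

namespace DLM

/-! Take `s_t = -∇h(r_t)`. The claim then splits into three parts: `h` is smooth on `S`; the error
`w_t = d_t + ∇h(r_t)` is of order `γ_t` for all `t` at once with probability at least `1 - δ`; and
these two facts force convergence.

Smoothness. `S` need be neither convex nor open, so smoothness takes the form `SmoothOn`: a
quadratic Taylor remainder and a Lipschitz gradient for every pair of points of `S`, without
reference to the segment between them. For the loss this reduces to Gaussian smoothing on the line,
with derivative `E φ'` in the mean and `E φ'' / 2` in the variance (`abs_smooth_sub_sub_le`). The
second derivative `φ''` is only bounded, yet `E φ''` is Lipschitz because Stein's identity `E[φ' ε]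
= √v E φ''` trades a derivative for a factor `ε` (`abs_smooth_deriv_sub_le`). For the KL term the
closed form is available. Nonnegativity of the divergence between centred Gaussians is exactly the
tangent line inequality for `log det`, and this inequality used at both endpoints controls the
remainder (`abs_kl_sub_sub_le`). The same estimates on the larger set with `ζ` and `lam` halved, a
neighbourhood of each point of `S`, show that the candidate gradient is the true one.

Errors. The parameters and the sample size of step `t` are fixed by the past, so Hoeffding's
inequality applies after freezing them (`measure_sample_deviation_le`). Off an event of probability
`δ_t` all `3n` averages are accurate up to `γ_t` times their scale. For `γ_t ≤ 1/2` the quotients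
inherit an error of order `γ_t` (`abs_div_sub_div_le`), and the KL gradients cancel. Since `γ_t →
0`, only finitely many steps have `γ_t > 1/2`; there a deterministic bound on the random direction,
valid up to probability `δ_t`, is enough.

Convergence. The descent inequality shows that `h(r_t)` converges and `∑ γ_t ‖∇h(r_t)‖²` is finite.
Hence `min(‖∇h(r_t)‖, 1)³` has summable increments and converges; a positive limit would contradict
`∑ γ_t = ∞`. -/

/-- A quadratic bound on the remainder of the linear approximation identifies the gradient. -/
theorem hasGradientAt_of_quadratic {E : Type*} [NormedAddCommGroup E] [InnerProductSpace ℝ E]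
    [CompleteSpace E] {f : E → ℝ} {v x : E} {C : ℝ}
    (h : ∀ᶠ y in 𝓝 x, |f y - f x - inner ℝ v (y - x)| ≤ C * ‖y - x‖ ^ 2) :
    HasGradientAt f v x := by
  rw [hasGradientAt_iff_isLittleO]
  have h1 : (fun y => f y - f x - inner ℝ v (y - x)) =O[𝓝 x] fun y => ‖y - x‖ ^ 2 := by
    refine Asymptotics.IsBigO.of_bound C ?_
    filter_upwards [h] with y hy
    simpa [abs_of_nonneg] using hy
  refine h1.trans_isLittleO ?_
  have h2 : (fun y : E => ‖y - x‖ ^ 2) =o[𝓝 x] fun y => ‖y - x‖ := by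
    have h3 : Tendsto (fun y : E => ‖y - x‖) (𝓝 x) (𝓝 0) := by
      have : Continuous fun y : E => ‖y - x‖ := by fun_prop
      simpa using this.tendsto x
    have := (Asymptotics.isLittleO_pow_id (𝕜 := ℝ) one_lt_two).comp_tendsto h3
    simpa [Function.comp_def] using this
  exact h2.of_norm_right

/-! ### Deterministic convergence of descent with errors -/

/-- The derivative of `u ^ 3` is of order `u ^ 2`, so a change of size `c` in the argument costs `c
* x ^ 2` plus a second order term. With `c = γ t` and `x = g t` both are summable, which dictates
the exponent 3. The truncation at 1 handles large `x`, where the permitted change `c * (1 + x)` is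
itself at most `2 * c * x ^ 2`. -/
theorem abs_min_one_pow_three_sub_le {x y A c : ℝ} (hx : 0 ≤ x) (hy : 0 ≤ y) (hA : 0 ≤ A)
    (hc : 0 ≤ c) (h : |y - x| ≤ A * c * (1 + x)) :
    |min y 1 ^ 3 - min x 1 ^ 3| ≤ (6 * A + 12 * A ^ 2) * (c * x ^ 2 + c ^ 2) := by
  set u := min x 1 with hu
  set v := min y 1 with hv
  have hu0 : 0 ≤ u := le_min hx zero_le_one
  have hv0 : 0 ≤ v := le_min hy zero_le_one
  have hu1 : u ≤ 1 := min_le_right _ _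
  have hv1 : v ≤ 1 := min_le_right _ _
  have huv : |v - u| ≤ |y - x| := by
    simpa using abs_min_sub_min_le_max y 1 x 1
  have hfac : |v ^ 3 - u ^ 3| = |v - u| * (v ^ 2 + v * u + u ^ 2) := by
    rw [show v ^ 3 - u ^ 3 = (v - u) * (v ^ 2 + v * u + u ^ 2) by ring, abs_mul,
      abs_of_nonneg (by positivity : 0 ≤ v ^ 2 + v * u + u ^ 2)]
  rw [hfac]
  have hAc : 0 ≤ A * c := by positivity
  rcases le_total 1 x with h1 | h1
  · have h3 : v ^ 2 + v * u + u ^ 2 ≤ 3 := by nlinarith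
    calc |v - u| * (v ^ 2 + v * u + u ^ 2) ≤ (A * c * (1 + x)) * 3 := by
          gcongr
          exact huv.trans h
      _ ≤ (6 * A) * (c * x ^ 2) := by
          have : 1 + x ≤ 2 * x ^ 2 := by nlinarith
          nlinarith
      _ ≤ (6 * A + 12 * A ^ 2) * (c * x ^ 2 + c ^ 2) := by
          gcongr
          · nlinarith [sq_nonneg A]
          · nlinarith [sq_nonneg c]
  · have hux : u = x := min_eq_left h1
    have hd : |v - u| ≤ 2 * (A * c) := by
      refine (huv.trans h).trans ?_
      nlinarith
    have hvu : v ≤ u + 2 * (A * c) := by linarith [le_abs_self (v - u)]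
    have hd0 : 0 ≤ 2 * (A * c) := by positivity
    have hb : v ^ 2 + v * u + u ^ 2 ≤ 3 * u ^ 2 + 3 * (2 * (A * c)) := by
      have e1 : v * u ≤ u ^ 2 + 2 * (A * c) := by nlinarith
      have e2 : v ^ 2 ≤ v * u + 2 * (A * c) := by nlinarith
      linarith
    calc |v - u| * (v ^ 2 + v * u + u ^ 2)
        ≤ (2 * (A * c)) * (3 * u ^ 2 + 3 * (2 * (A * c))) := by gcongr
      _ = 6 * A * (c * x ^ 2) + 12 * A ^ 2 * c ^ 2 := by rw [hux]; ring
      _ ≤ (6 * A + 12 * A ^ 2) * (c * x ^ 2 + c ^ 2) := by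
          have := sq_nonneg A
          have : 0 ≤ A * c ^ 2 := by positivity
          have : 0 ≤ A ^ 2 * (c * x ^ 2) := by positivity
          nlinarith

/-- Summability alone gives only a vanishing lower limit. The variation bound makes the truncated
cubes of `g` Cauchy, so they have a limit, and divergence of `∑ γ` excludes a positive one. -/
theorem tendsto_zero_of_summable_mul_sq {g γ : ℕ → ℝ} {A : ℝ} (hg : ∀ t, 0 ≤ g t) (hA : 0 ≤ A)
    (hγ : ∀ t, 0 < γ t)
    (hγ_sum : Tendsto (fun T => ∑ t ∈ Finset.range T, γ t) atTop atTop)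
    (hγ_sq : Summable fun t => γ t ^ 2) (hs : Summable fun t => γ t * g t ^ 2)
    (hvar : ∀ t, |g (t + 1) - g t| ≤ A * γ t * (1 + g t)) :
    Tendsto g atTop (𝓝 0) := by
  have hcau : CauchySeq fun t => min (g t) 1 ^ 3 := by
    refine cauchySeq_of_dist_le_of_summable _ (fun t => ?_)
      ((hs.add hγ_sq).mul_left (6 * A + 12 * A ^ 2))
    rw [dist_comm, Real.dist_eq]
    exact abs_min_one_pow_three_sub_le (hg t) (hg _) hA (hγ t).le (hvar t)
  obtain ⟨l, hl⟩ := cauchySeq_tendsto_of_complete hcau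
  have hl0 : 0 ≤ l := ge_of_tendsto' hl fun t => by have := hg t; positivity
  rcases hl0.eq_or_lt with rfl | hlpos
  · rw [Metric.tendsto_atTop]
    intro e he
    have he' : 0 < min e 1 ^ 3 := by positivity
    obtain ⟨T, hT⟩ := (hl.eventually (gt_mem_nhds he')).exists_forall_of_atTop
    refine ⟨T, fun t ht => ?_⟩
    have h1 : min (g t) 1 < min e 1 :=
      lt_of_pow_lt_pow_left₀ 3 (by positivity) (hT t ht)
    rw [Real.dist_eq, sub_zero, abs_of_nonneg (hg t)]
    by_contra hcon
    exact absurd (min_le_min_right 1 (not_lt.1 hcon)) (not_le.2 h1)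
  · exfalso
    obtain ⟨T, hT⟩ := (hl.eventually (lt_mem_nhds (half_lt_self hlpos))).exists_forall_of_atTop
    -- A positive limit keeps `g ^ 2` away from zero, since on `[0, 1]` the cube is below the
    -- square; then `γ` would be summable together with `γ * g ^ 2`.
    have hge : ∀ t ≥ T, l / 2 ≤ g t ^ 2 := by
      intro t ht
      have h0 : 0 ≤ min (g t) 1 := le_min (hg t) zero_le_one
      have h1 : min (g t) 1 ^ 3 ≤ min (g t) 1 ^ 2 :=
        pow_le_pow_of_le_one h0 (min_le_right _ _) (by norm_num)
      have h2 : min (g t) 1 ^ 2 ≤ g t ^ 2 := by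
        gcongr
        exact min_le_left _ _
      linarith [hT t ht]
    have hsum : Summable γ := by
      rw [← summable_nat_add_iff T]
      refine Summable.of_nonneg_of_le (fun t => (hγ _).le) (fun t => ?_)
        (((summable_nat_add_iff T).2 hs).mul_left (2 / l))
      have := hge (t + T) (by omega)
      have h3 := mul_le_mul_of_nonneg_left this (hγ (t + T)).le
      calc γ (t + T) = 2 / l * (γ (t + T) * (l / 2)) := by field_simp
        _ ≤ _ := by gcongr
    exact not_tendsto_nhds_of_tendsto_atTop hγ_sum _ hsum.hasSum.tendsto_sum_nat

/-- For small steps half of the decrease absorbs the error term in `g ^ 2`. What remains of the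
error is `A * γ ^ 2`; subtracting its partial sums makes `H` monotone, and telescoping sums the
decreases. -/
theorem convergence_of_descent_aux {H g γ : ℕ → ℝ} {A m : ℝ} (hA : 0 ≤ A)
    (hγ : ∀ t, 0 < γ t) (hγ_sq : Summable fun t => γ t ^ 2) (hsmall : ∀ t, γ t * A ≤ 1 / 2)
    (hdec : ∀ t, H (t + 1) ≤ H t - γ t * g t ^ 2 + γ t ^ 2 * (A * (1 + g t ^ 2)))
    (hlow : ∀ t, m ≤ H t) :
    (∃ l, Tendsto H atTop (𝓝 l)) ∧ Summable fun t => γ t * g t ^ 2 := by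
  have hdec' : ∀ t, H (t + 1) ≤ H t - γ t * g t ^ 2 / 2 + A * γ t ^ 2 := by
    intro t
    have h1 : γ t * A * (γ t * g t ^ 2) ≤ 1 / 2 * (γ t * g t ^ 2) :=
      mul_le_mul_of_nonneg_right (hsmall t) (mul_nonneg (hγ t).le (sq_nonneg _))
    nlinarith [hdec t]
  have hpart : ∀ t, ∑ s ∈ Finset.range t, γ s ^ 2 ≤ ∑' s, γ s ^ 2 := fun t =>
    hγ_sq.sum_le_tsum _ fun s _ => sq_nonneg _
  constructor
  · have hanti : Antitone fun t => H t - A * ∑ s ∈ Finset.range t, γ s ^ 2 := by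
      refine antitone_nat_of_succ_le fun t => ?_
      rw [Finset.sum_range_succ]
      have := mul_nonneg (hγ t).le (sq_nonneg (g t))
      linarith [hdec' t]
    have hbdd : BddBelow (Set.range fun t => H t - A * ∑ s ∈ Finset.range t, γ s ^ 2) := by
      refine ⟨m - A * ∑' s, γ s ^ 2, ?_⟩
      rintro _ ⟨t, rfl⟩
      have := mul_le_mul_of_nonneg_left (hpart t) hA
      simp only
      linarith [hlow t]
    have h1 := tendsto_atTop_ciInf hanti hbdd
    have h2 := h1.add (hγ_sq.hasSum.tendsto_sum_nat.const_mul A)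
    exact ⟨_, h2.congr fun t => by ring⟩
  · have hsum : ∀ t, ∑ s ∈ Finset.range t, γ s * g s ^ 2 ≤
        2 * (H 0 - H t + A * ∑ s ∈ Finset.range t, γ s ^ 2) := by
      intro t
      induction t with
      | zero => simp
      | succ t ih =>
        rw [Finset.sum_range_succ, Finset.sum_range_succ]
        linarith [hdec' t]
    refine summable_of_sum_range_le (c := 2 * (H 0 - m + A * ∑' s, γ s ^ 2))
      (fun t => mul_nonneg (hγ t).le (sq_nonneg _)) fun t => (hsum t).trans ?_
    have := mul_le_mul_of_nonneg_left (hpart t) hA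
    linarith [hlow t]

/-- Convergence of a descent method with errors, in terms of the function values `H t` and the
gradient norms `g t`. -/
theorem convergence_of_descent {H g γ : ℕ → ℝ} {A m : ℝ} (hA : 0 ≤ A) (hg : ∀ t, 0 ≤ g t)
    (hγ : ∀ t, 0 < γ t)
    (hγ_sum : Tendsto (fun T => ∑ t ∈ Finset.range T, γ t) atTop atTop)
    (hγ_sq : Summable fun t => γ t ^ 2)
    (hdec : ∀ t, H (t + 1) ≤ H t - γ t * g t ^ 2 + γ t ^ 2 * (A * (1 + g t ^ 2)))
    (hlow : ∀ t, m ≤ H t)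
    (hvar : ∀ t, |g (t + 1) - g t| ≤ A * γ t * (1 + g t)) :
    (∃ l, Tendsto H atTop (𝓝 l)) ∧ Tendsto g atTop (𝓝 0) := by
  have hγ0 : Tendsto (fun t => γ t * A) atTop (𝓝 0) := by
    have h1 : Tendsto (fun t => √(γ t ^ 2)) atTop (𝓝 0) := by
      simpa using hγ_sq.tendsto_atTop_zero.sqrt
    have h2 : Tendsto γ atTop (𝓝 0) := h1.congr fun t => Real.sqrt_sq (hγ t).le
    simpa using h2.mul_const A
  obtain ⟨T, hT⟩ :=
    (hγ0.eventually (ge_mem_nhds (by norm_num : (0 : ℝ) < 1 / 2))).exists_forall_of_atTop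
  -- The smallness of the steps holds from `T` on, and both conclusions are insensitive to a shift.
  obtain ⟨⟨l, hl⟩, hs⟩ := convergence_of_descent_aux (H := fun t => H (t + T))
    (g := fun t => g (t + T)) (γ := fun t => γ (t + T)) (m := m) hA (fun t => hγ _)
    ((summable_nat_add_iff T).2 hγ_sq) (fun t => hT _ (by omega))
    (fun t => by simpa only [add_right_comm] using hdec (t + T)) (fun t => hlow _)
  exact ⟨⟨l, (tendsto_add_atTop_iff_nat T).1 hl⟩, tendsto_zero_of_summable_mul_sq hg hA hγ hγ_sum
    hγ_sq ((summable_nat_add_iff T).1 hs) hvar⟩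

/-- Convergence of the gradient method with errors for a function that satisfies the descent
inequality between consecutive iterates. -/
theorem gradient_method_with_errors_convergence {E : Type*} [NormedAddCommGroup E]
    [InnerProductSpace ℝ E] {h : E → ℝ} {G : E → E} {γ : ℕ → ℝ} {r d : ℕ → E}
    {c₃ c₄ C Λ m : ℝ} (hc₃ : 0 ≤ c₃) (hc₄ : 0 ≤ c₄) (hC : 0 ≤ C) (hΛ : 0 ≤ Λ)
    (hγ : ∀ t, 0 < γ t)
    (hγ_sum : Tendsto (fun T => ∑ t ∈ Finset.range T, γ t) atTop atTop)
    (hγ_sq : Summable fun t => γ t ^ 2)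
    (hstep : ∀ t, r (t + 1) = r t + γ t • d t)
    (herr : ∀ t, ‖d t + G (r t)‖ ≤ γ t * (c₃ + c₄ * ‖G (r t)‖))
    (hquad : ∀ t, h (r (t + 1)) ≤
      h (r t) + inner ℝ (G (r t)) (r (t + 1) - r t) + C * ‖r (t + 1) - r t‖ ^ 2)
    (hlip : ∀ t, ‖G (r (t + 1)) - G (r t)‖ ≤ Λ * ‖r (t + 1) - r t‖)
    (hlow : ∀ t, m ≤ h (r t)) :
    (∃ l, Tendsto (fun t => h (r t)) atTop (𝓝 l)) ∧
      Tendsto (fun t => G (r t)) atTop (𝓝 0) := by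
  obtain ⟨Γ, hΓ⟩ : ∃ Γ, ∀ t, γ t ≤ Γ := by
    refine ⟨√(∑' t, γ t ^ 2), fun t => Real.le_sqrt_of_sq_le ?_⟩
    exact hγ_sq.le_tsum t fun _ _ => sq_nonneg _
  have hΓ0 : 0 ≤ Γ := (hγ 0).le.trans (hΓ 0)
  set K : ℝ := 1 + Γ * c₃ + Γ * c₄ with hK
  have hK0 : 0 ≤ K := by positivity
  have hd : ∀ t, ‖d t‖ ≤ K * (1 + ‖G (r t)‖) := by
    intro t
    have h1 : ‖d t‖ ≤ ‖d t + G (r t)‖ + ‖G (r t)‖ := by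
      simpa using norm_sub_le (d t + G (r t)) (G (r t))
    have hg := norm_nonneg (G (r t))
    have h2 : γ t * (c₃ + c₄ * ‖G (r t)‖) ≤ Γ * (c₃ + c₄ * ‖G (r t)‖) := by
      gcongr
      exact hΓ t
    have h3 := herr t
    rw [hK]
    nlinarith [mul_nonneg hΓ0 hc₃, mul_nonneg hΓ0 hc₄, mul_nonneg (mul_nonneg hΓ0 hc₃) hg]
  have hdiff : ∀ t, r (t + 1) - r t = γ t • d t := fun t => by rw [hstep t]; simp
  have hnd : ∀ t, ‖r (t + 1) - r t‖ ≤ γ t * (K * (1 + ‖G (r t)‖)) := by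
    intro t
    rw [hdiff, norm_smul, Real.norm_of_nonneg (hγ t).le]
    exact mul_le_mul_of_nonneg_left (hd t) (hγ t).le
  -- The three summands pay for the inner product of the gradient with the error, for the quadratic
  -- remainder of `h`, and for the variation of the gradient norm.
  set A : ℝ := 2 * (c₃ + c₄) + 2 * C * K ^ 2 + Λ * K with hA
  have hA0 : 0 ≤ A := by positivity
  have key := convergence_of_descent (H := fun t => h (r t)) (g := fun t => ‖G (r t)‖)
    (m := m) hA0 (fun t => norm_nonneg _) hγ hγ_sum hγ_sq ?_ hlow ?_
  · exact ⟨key.1, tendsto_zero_iff_norm_tendsto_zero.2 key.2⟩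
  · intro t
    have hg := norm_nonneg (G (r t))
    have hγt := (hγ t).le
    have h1 : inner ℝ (G (r t)) (r (t + 1) - r t) ≤
        - γ t * ‖G (r t)‖ ^ 2 + γ t ^ 2 * (‖G (r t)‖ * (c₃ + c₄ * ‖G (r t)‖)) := by
      have e1 : inner ℝ (G (r t)) (r (t + 1) - r t) =
          - γ t * ‖G (r t)‖ ^ 2 + γ t * inner ℝ (G (r t)) (d t + G (r t)) := by
        rw [hdiff, inner_smul_right, inner_add_right, real_inner_self_eq_norm_sq]
        ring
      have e2 : inner ℝ (G (r t)) (d t + G (r t)) ≤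
          ‖G (r t)‖ * (γ t * (c₃ + c₄ * ‖G (r t)‖)) :=
        (real_inner_le_norm _ _).trans (mul_le_mul_of_nonneg_left (herr t) hg)
      rw [e1]
      nlinarith [mul_le_mul_of_nonneg_left e2 hγt]
    have h2 : ‖r (t + 1) - r t‖ ^ 2 ≤ γ t ^ 2 * (K ^ 2 * (2 * (1 + ‖G (r t)‖ ^ 2))) := by
      calc ‖r (t + 1) - r t‖ ^ 2 ≤ (γ t * (K * (1 + ‖G (r t)‖))) ^ 2 := by
            gcongr
            exact hnd t
        _ = γ t ^ 2 * (K ^ 2 * (1 + ‖G (r t)‖) ^ 2) := by ring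
        _ ≤ _ := by
            gcongr
            nlinarith [sq_nonneg (1 - ‖G (r t)‖)]
    have h3 : ‖G (r t)‖ * (c₃ + c₄ * ‖G (r t)‖) ≤ 2 * (c₃ + c₄) * (1 + ‖G (r t)‖ ^ 2) := by
      nlinarith [sq_nonneg (1 - ‖G (r t)‖), mul_nonneg hc₃ (sq_nonneg (1 - ‖G (r t)‖)),
        mul_nonneg hc₄ (sq_nonneg (‖G (r t)‖)), mul_nonneg hc₃ (sq_nonneg (‖G (r t)‖))]
    have h4 := hquad t
    have h5 := mul_le_mul_of_nonneg_left h3 (sq_nonneg (γ t))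
    have h6 := mul_le_mul_of_nonneg_left h2 hC
    have h7 : 0 ≤ γ t ^ 2 * (Λ * K * (1 + ‖G (r t)‖ ^ 2)) := by positivity
    have h8 : γ t ^ 2 * (A * (1 + ‖G (r t)‖ ^ 2)) =
      γ t ^ 2 * (2 * (c₃ + c₄) * (1 + ‖G (r t)‖ ^ 2)) +
      C * (γ t ^ 2 * (K ^ 2 * (2 * (1 + ‖G (r t)‖ ^ 2)))) +
      γ t ^ 2 * (Λ * K * (1 + ‖G (r t)‖ ^ 2)) := by rw [hA]; ring
    rw [h8]
    linarith
  · intro t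
    have hg := norm_nonneg (G (r t))
    refine (abs_norm_sub_norm_le _ _).trans ((hlip t).trans ?_)
    calc Λ * ‖r (t + 1) - r t‖ ≤ Λ * (γ t * (K * (1 + ‖G (r t)‖))) := by
          gcongr
          exact hnd t
      _ = (Λ * K) * γ t * (1 + ‖G (r t)‖) := by ring
      _ ≤ A * γ t * (1 + ‖G (r t)‖) := by
          have := (hγ t).le
          gcongr
          rw [hA]
          have : 0 ≤ 2 * (c₃ + c₄) + 2 * C * K ^ 2 := by positivity
          linarith

/-! ### Gaussian smoothing on the line -/

/-- The expectation of `ψ` under `N(μ, v)`, through the reparameterization `√v ε + μ`. -/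
def smooth (ψ : ℝ → ℝ) (μ v : ℝ) : ℝ := ∫ ε, ψ (√v * ε + μ) ∂(gaussianReal 0 1)

theorem integral_gaussianReal_eq_smooth {ψ : ℝ → ℝ} (hψ : Measurable ψ) (μ : ℝ) {v : ℝ}
    (hv : 0 ≤ v) : ∫ f, ψ f ∂(gaussianReal μ v.toNNReal) = smooth ψ μ v := by
  have h1 : (gaussianReal 0 1).map (fun ε => √v * ε + μ) = gaussianReal μ v.toNNReal := by
    have : (fun ε => √v * ε + μ) = (fun x => x + μ) ∘ (fun ε => √v * ε) := rfl
    rw [this, ← Measure.map_map (by fun_prop) (by fun_prop), gaussianReal_map_const_mul,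
      gaussianReal_map_add_const]
    congr 1
    · simp
    · ext
      simp [Real.sq_sqrt hv, hv]
  rw [← h1, integral_map (by fun_prop) hψ.aestronglyMeasurable]
  rfl

theorem integrable_id_stdGaussianReal : Integrable (fun ε : ℝ => ε) (gaussianReal 0 1) :=
  (memLp_id_gaussianReal 1).integrable le_rfl

theorem integrable_sq_stdGaussianReal : Integrable (fun ε : ℝ => ε ^ 2) (gaussianReal 0 1) :=
  (memLp_id_gaussianReal 2).integrable_sq

theorem integral_sq_stdGaussianReal : ∫ ε, ε ^ 2 ∂(gaussianReal 0 1) = 1 := by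
  have h := variance_fun_id_gaussianReal (μ := 0) (v := 1)
  rw [variance_of_integral_eq_zero (by fun_prop) (by simp)] at h
  simpa using h

theorem integrable_abs_stdGaussianReal : Integrable (fun ε : ℝ => |ε|) (gaussianReal 0 1) :=
  integrable_id_stdGaussianReal.abs

theorem integral_abs_stdGaussianReal_le : ∫ ε, |ε| ∂(gaussianReal 0 1) ≤ 1 := by
  have h1 : ∫ ε, |ε| ∂(gaussianReal 0 1) ≤ ∫ ε, (1 / 2 + 1 / 2 * ε ^ 2) ∂(gaussianReal 0 1) := by
    refine integral_mono integrable_abs_stdGaussianReal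
      ((integrable_const _).add (integrable_sq_stdGaussianReal.const_mul _)) fun ε => ?_
    have := sq_nonneg (1 - |ε|)
    simp only
    nlinarith [sq_abs ε]
  rw [integral_add (integrable_const _) (integrable_sq_stdGaussianReal.const_mul _),
    integral_const_mul, integral_sq_stdGaussianReal] at h1
  simpa using h1.trans (by norm_num)

section Bounded

variable {ψ : ℝ → ℝ} {M : ℝ}

theorem integrable_comp_affine (hψ : Measurable ψ) (hM : ∀ x, |ψ x| ≤ M) (σ μ : ℝ) :
    Integrable (fun ε => ψ (σ * ε + μ)) (gaussianReal 0 1) :=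
  Integrable.of_bound (hψ.comp (by fun_prop)).aestronglyMeasurable M (ae_of_all _ fun _ => hM _)

theorem integrable_comp_affine_mul_id (hψ : Measurable ψ) (hM : ∀ x, |ψ x| ≤ M) (σ μ : ℝ) :
    Integrable (fun ε => ψ (σ * ε + μ) * ε) (gaussianReal 0 1) :=
  integrable_id_stdGaussianReal.bdd_mul (hψ.comp (by fun_prop)).aestronglyMeasurable
    (ae_of_all _ fun _ => hM _)

theorem abs_integral_comp_affine_le (hψ : Measurable ψ) (hM : ∀ x, |ψ x| ≤ M) (σ μ : ℝ) :
    |∫ ε, ψ (σ * ε + μ) ∂(gaussianReal 0 1)| ≤ M := by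
  refine abs_le.2 ⟨?_, ?_⟩
  · have := integral_mono (integrable_const (-M)) (integrable_comp_affine hψ hM σ μ)
      fun ε => (abs_le.1 (hM (σ * ε + μ))).1
    simpa using this
  · have := integral_mono (integrable_comp_affine hψ hM σ μ) (integrable_const M)
      fun ε => (abs_le.1 (hM (σ * ε + μ))).2
    simpa using this

theorem abs_integral_comp_affine_sub_le {K : ℝ} (hψ : Measurable ψ) (hM : ∀ x, |ψ x| ≤ M)
    (hK : ∀ x y, |ψ y - ψ x| ≤ K * |y - x|) (σ σ' μ μ' : ℝ) :
    |∫ ε, ψ (σ' * ε + μ') ∂(gaussianReal 0 1) - ∫ ε, ψ (σ * ε + μ) ∂(gaussianReal 0 1)| ≤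
      K * (|σ' - σ| + |μ' - μ|) := by
  have hK0 : 0 ≤ K := by simpa using (abs_nonneg _).trans (hK 0 1)
  rw [← integral_sub (integrable_comp_affine hψ hM _ _) (integrable_comp_affine hψ hM _ _)]
  refine abs_integral_le_integral_abs.trans ?_
  calc ∫ ε, |ψ (σ' * ε + μ') - ψ (σ * ε + μ)| ∂(gaussianReal 0 1)
      ≤ ∫ ε, K * (|σ' - σ| * |ε| + |μ' - μ|) ∂(gaussianReal 0 1) := by
        refine integral_mono ((integrable_comp_affine hψ hM _ _).sub
          (integrable_comp_affine hψ hM _ _)).abs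
          (((integrable_abs_stdGaussianReal.const_mul _).add (integrable_const _)).const_mul _)
          fun ε => (hK _ _).trans ?_
        gcongr
        rw [← abs_mul]
        refine le_trans (le_of_eq ?_) (abs_add_le _ _)
        congr 1
        ring
    _ ≤ K * (|σ' - σ| + |μ' - μ|) := by
        rw [integral_const_mul, integral_add (integrable_abs_stdGaussianReal.const_mul _)
          (integrable_const _), integral_const_mul]
        simp only [integral_const, probReal_univ, one_smul]
        gcongr
        exact mul_le_of_le_one_right (abs_nonneg _) integral_abs_stdGaussianReal_le

/-- The factor `ε` raises the moments in play from `|ε|` and `1` to `ε ^ 2` and `|ε|`, whose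
expectations are still at most 1. This is the form that Stein's identity needs. -/
theorem abs_integral_comp_affine_mul_id_sub_le {K : ℝ} (hψ : Measurable ψ) (hM : ∀ x, |ψ x| ≤ M)
    (hK : ∀ x y, |ψ y - ψ x| ≤ K * |y - x|) (σ σ' μ μ' : ℝ) :
    |∫ ε, ψ (σ' * ε + μ') * ε ∂(gaussianReal 0 1) - ∫ ε, ψ (σ * ε + μ) * ε ∂(gaussianReal 0 1)| ≤
      K * (|σ' - σ| + |μ' - μ|) := by
  have hK0 : 0 ≤ K := by simpa using (abs_nonneg _).trans (hK 0 1)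
  have hi := integrable_comp_affine_mul_id hψ hM
  rw [← integral_sub (hi _ _) (hi _ _)]
  refine abs_integral_le_integral_abs.trans ?_
  calc ∫ ε, |ψ (σ' * ε + μ') * ε - ψ (σ * ε + μ) * ε| ∂(gaussianReal 0 1)
      ≤ ∫ ε, K * (|σ' - σ| * ε ^ 2 + |μ' - μ| * |ε|) ∂(gaussianReal 0 1) := by
        refine integral_mono ((hi _ _).sub (hi _ _)).abs
          (((integrable_sq_stdGaussianReal.const_mul _).add
            (integrable_abs_stdGaussianReal.const_mul _)).const_mul _) fun ε => ?_
        simp only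
        rw [← sub_mul, abs_mul]
        calc |ψ (σ' * ε + μ') - ψ (σ * ε + μ)| * |ε|
            ≤ (K * |(σ' * ε + μ') - (σ * ε + μ)|) * |ε| := by
              gcongr
              exact hK _ _
          _ ≤ (K * (|σ' - σ| * |ε| + |μ' - μ|)) * |ε| := by
              gcongr
              rw [← abs_mul]
              refine le_trans (le_of_eq ?_) (abs_add_le _ _)
              congr 1
              ring
          _ = _ := by rw [← sq_abs ε]; ring
    _ ≤ K * (|σ' - σ| + |μ' - μ|) := by
        rw [integral_const_mul, integral_add (integrable_sq_stdGaussianReal.const_mul _)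
          (integrable_abs_stdGaussianReal.const_mul _), integral_const_mul, integral_const_mul,
          integral_sq_stdGaussianReal, mul_one]
        gcongr
        exact mul_le_of_le_one_right (abs_nonneg _) integral_abs_stdGaussianReal_le

end Bounded

/-- Stein's lemma for the standard normal distribution. -/
theorem integral_mul_id_eq_integral_deriv {u : ℝ → ℝ} {M M' : ℝ} (hu : Differentiable ℝ u)
    (hM : ∀ x, |u x| ≤ M) (hM' : ∀ x, |deriv u x| ≤ M') :
    ∫ ε, u ε * ε ∂(gaussianReal 0 1) = ∫ ε, deriv u ε ∂(gaussianReal 0 1) := by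
  have h1 : (1 : ℝ≥0) ≠ 0 := one_ne_zero
  set w : ℝ → ℝ := gaussianPDFReal 0 1 with hw
  have hwd : ∀ x, HasDerivAt w (-(x * w x)) x := by
    intro x
    have e : w = fun x => (√(2 * Real.pi * (1 : ℝ≥0)))⁻¹ *
        Real.exp (-(x - 0) ^ 2 / (2 * (1 : ℝ≥0))) := gaussianPDFReal_def 0 1
    rw [e]
    have h2 : HasDerivAt (fun x : ℝ => -(x - 0) ^ 2 / (2 * ((1 : ℝ≥0) : ℝ))) (-x) x := by
      have := (((hasDerivAt_id x).sub_const 0).pow 2).neg.div_const (2 * ((1 : ℝ≥0) : ℝ))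
      convert! this using 1
      simp only [NNReal.coe_one, id_eq]
      push_cast
      ring
    convert! h2.exp.const_mul _ using 1
    ring
  have hden : ∀ {f : ℝ → ℝ}, Integrable f (gaussianReal 0 1) → Integrable fun x => f x * w x := by
    intro f hf
    rw [gaussianReal_of_var_ne_zero 0 h1,
      integrable_withDensity_iff (measurable_gaussianPDF 0 1)
        (ae_of_all _ fun x => gaussianPDF_lt_top)] at hf
    simpa [toReal_gaussianPDF] using hf
  have hmeas : Measurable u := hu.continuous.measurable
  have i1 : Integrable fun x => deriv u x * w x :=
    hden (Integrable.of_bound (measurable_deriv u).aestronglyMeasurable M' (ae_of_all _ hM'))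
  have i2 : Integrable fun x => (u x * x) * w x :=
    hden (by simpa using integrable_comp_affine_mul_id hmeas hM 1 0)
  have i3 : Integrable fun x => u x * w x :=
    hden (Integrable.of_bound hmeas.aestronglyMeasurable M (ae_of_all _ hM))
  -- The density satisfies `w' = -x w`, so the integral of `(u w)' = u' w - x u w` over the line is
  -- zero.
  have key := integral_eq_zero_of_hasDerivAt_of_integrable (f := fun x => u x * w x)
    (f' := fun x => deriv u x * w x + u x * (-(x * w x)))
    (fun x => (hu x).hasDerivAt.mul (hwd x))
    (i1.add (i2.neg.congr (ae_of_all _ fun x => by simp only [Pi.neg_apply]; ring))) i3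
  have e2 : ∫ x, u x * (-(x * w x)) = - ∫ x, (u x * x) * w x := by
    rw [← integral_neg]
    congr 1
    ext x
    ring
  rw [integral_add i1 (i2.neg.congr (ae_of_all _ fun x => by simp only [Pi.neg_apply]; ring)),
    e2] at key
  rw [integral_gaussianReal_eq_integral_smul h1, integral_gaussianReal_eq_integral_smul h1]
  simp only [smul_eq_mul]
  simp_rw [mul_comm (gaussianPDFReal 0 1 _)]
  linarith

theorem integral_comp_affine_mul_id {ψ : ℝ → ℝ} {M : ℝ} (hψ : Differentiable ℝ ψ)
    (hM : ∀ x, |ψ x| ≤ M) (hM' : ∀ x, |deriv ψ x| ≤ M) (σ μ : ℝ) :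
    ∫ ε, ψ (σ * ε + μ) * ε ∂(gaussianReal 0 1) =
      σ * ∫ ε, deriv ψ (σ * ε + μ) ∂(gaussianReal 0 1) := by
  have hd : ∀ x, HasDerivAt (fun ε => ψ (σ * ε + μ)) (deriv ψ (σ * x + μ) * σ) x := by
    intro x
    have h1 : HasDerivAt (fun ε => σ * ε + μ) σ x := by
      simpa using ((hasDerivAt_id x).const_mul σ).add_const μ
    exact (hψ _).hasDerivAt.comp x h1
  have hM0 : 0 ≤ M := (abs_nonneg _).trans (hM 0)
  rw [integral_mul_id_eq_integral_deriv (u := fun ε => ψ (σ * ε + μ)) (M := M) (M' := M * |σ|)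
    (fun x => (hd x).differentiableAt) (fun x => hM _) (fun x => ?_), ← integral_const_mul]
  · congr 1
    ext x
    rw [(hd x).deriv, mul_comm]
  · rw [(hd x).deriv, abs_mul]
    gcongr
    exact hM' _

theorem abs_sub_le_of_abs_deriv_le {ψ : ℝ → ℝ} {M : ℝ} (hψ : Differentiable ℝ ψ)
    (hM : ∀ x, |deriv ψ x| ≤ M) (x y : ℝ) : |ψ y - ψ x| ≤ M * |y - x| :=
  convex_univ.norm_image_sub_le_of_norm_deriv_le (fun x _ => hψ x) (fun x _ => hM x)
    (Set.mem_univ x) (Set.mem_univ y)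

/-- Mean value inequality for `ψ` minus its tangent. The constant is not the sharp `M / 2`, but no
continuity of the second derivative is needed. -/
theorem abs_sub_sub_deriv_mul_le {ψ : ℝ → ℝ} {M : ℝ} (hψ : Differentiable ℝ ψ)
    (hψ' : Differentiable ℝ (deriv ψ)) (hM : ∀ x, |deriv (deriv ψ) x| ≤ M) (x y : ℝ) :
    |ψ y - ψ x - deriv ψ x * (y - x)| ≤ M * (y - x) ^ 2 := by
  have hM0 : 0 ≤ M := (abs_nonneg _).trans (hM 0)
  have hd : ∀ z, HasDerivAt (fun z => ψ z - deriv ψ x * z) (deriv ψ z - deriv ψ x) z := fun z =>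
    (hψ z).hasDerivAt.sub (by simpa using (hasDerivAt_id z).const_mul (deriv ψ x))
  have h := (convex_uIcc x y).norm_image_sub_le_of_norm_hasDerivWithin_le
    (fun z _ => (hd z).hasDerivWithinAt) (C := M * |y - x|) (fun z hz => ?_)
    Set.left_mem_uIcc Set.right_mem_uIcc
  · rw [Real.norm_eq_abs, Real.norm_eq_abs] at h
    calc |ψ y - ψ x - deriv ψ x * (y - x)|
        = |ψ y - deriv ψ x * y - (ψ x - deriv ψ x * x)| := by congr 1; ring
      _ ≤ M * |y - x| * |y - x| := h
      _ = M * (y - x) ^ 2 := by rw [← sq_abs (y - x)]; ring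
  · refine (abs_sub_le_of_abs_deriv_le hψ' hM x z).trans ?_
    refine mul_le_mul_of_nonneg_left ?_ hM0
    exact Set.abs_sub_left_of_mem_uIcc hz

theorem sqrt_le_sqrt_of_le_abs {v v' lam : ℝ} (hlam : 0 < lam) (hv : lam ≤ v) (hv' : lam ≤ v') :
    |√v' - √v| ≤ |v' - v| / √lam := by
  have h0 : 0 < √lam := Real.sqrt_pos.2 hlam
  have h1 : √lam ≤ √v := Real.sqrt_le_sqrt hv
  have h2 : √lam ≤ √v' := Real.sqrt_le_sqrt hv'
  have h3 : v' - v = (√v' - √v) * (√v' + √v) := by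
    have e1 := Real.sq_sqrt (hlam.le.trans hv)
    have e2 := Real.sq_sqrt (hlam.le.trans hv')
    nlinarith
  rw [le_div_iff₀ h0, h3, abs_mul]
  gcongr
  rw [abs_of_pos (by linarith)]
  linarith

section Smooth

variable {ψ : ℝ → ℝ} {M lam : ℝ}

theorem abs_smooth_le (hψ : Measurable ψ) (hM : ∀ x, |ψ x| ≤ M) (μ v : ℝ) :
    |smooth ψ μ v| ≤ M :=
  abs_integral_comp_affine_le hψ hM _ _

/-- Smoothing preserves Lipschitz continuity. -/
theorem abs_smooth_sub_le (hlam : 0 < lam) (hψ : Differentiable ℝ ψ) (hM : ∀ x, |ψ x| ≤ M)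
    (hM' : ∀ x, |deriv ψ x| ≤ M) {μ v μ' v' : ℝ} (hv : lam ≤ v) (hv' : lam ≤ v') :
    |smooth ψ μ' v' - smooth ψ μ v| ≤ M * (|v' - v| / √lam + |μ' - μ|) := by
  have hM0 : 0 ≤ M := (abs_nonneg _).trans (hM 0)
  refine (abs_integral_comp_affine_sub_le hψ.continuous.measurable hM
    (abs_sub_le_of_abs_deriv_le hψ hM') _ _ _ _).trans ?_
  gcongr
  exact sqrt_le_sqrt_of_le_abs hlam hv hv'

/-- The smoothed derivative of a bounded Lipschitz function is Lipschitz. -/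
theorem abs_smooth_deriv_sub_le (hlam : 0 < lam) (hψ : Differentiable ℝ ψ) (hM : ∀ x, |ψ x| ≤ M)
    (hM' : ∀ x, |deriv ψ x| ≤ M) {μ v μ' v' : ℝ} (hv : lam ≤ v) (hv' : lam ≤ v') :
    |smooth (deriv ψ) μ' v' - smooth (deriv ψ) μ v| ≤
      2 * M / √lam * (|v' - v| / √lam + |μ' - μ|) := by
  have hM0 : 0 ≤ M := (abs_nonneg _).trans (hM 0)
  have h0 : 0 < √lam := Real.sqrt_pos.2 hlam
  have h1 : √lam ≤ √v := Real.sqrt_le_sqrt hv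
  have h2 : √lam ≤ √v' := Real.sqrt_le_sqrt hv'
  -- Multiplied by `√v`, the smoothed derivative becomes the expectation of `ψ` times `ε`, which is
  -- Lipschitz because `ψ` is. The factor `√v ≥ √lam` is divided out at the end.
  have e : √v * smooth (deriv ψ) μ v = _ := (integral_comp_affine_mul_id hψ hM hM' (√v) μ).symm
  have e' : √v' * smooth (deriv ψ) μ' v' = _ :=
    (integral_comp_affine_mul_id hψ hM hM' (√v') μ').symm
  have hT := abs_integral_comp_affine_mul_id_sub_le hψ.continuous.measurable hM
    (abs_sub_le_of_abs_deriv_le hψ hM') (√v) (√v') μ μ'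
  rw [← e, ← e'] at hT
  have hs := abs_smooth_le (measurable_deriv ψ) hM' μ v
  have hsq := sqrt_le_sqrt_of_le_abs hlam hv hv'
  set S := smooth (deriv ψ) μ v
  set S' := smooth (deriv ψ) μ' v'
  have h3 : √v' * (S' - S) = (√v' * S' - √v * S) - (√v' - √v) * S := by ring
  have h4 : √v' * |S' - S| ≤ 2 * M * (|v' - v| / √lam + |μ' - μ|) := by
    rw [← abs_of_pos (h0.trans_le h2), ← abs_mul, h3]
    calc |(√v' * S' - √v * S) - (√v' - √v) * S|
        ≤ |√v' * S' - √v * S| + |(√v' - √v) * S| := abs_sub _ _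
      _ ≤ M * (|√v' - √v| + |μ' - μ|) + |√v' - √v| * M := by
          rw [abs_mul]
          gcongr
      _ ≤ 2 * M * (|√v' - √v| + |μ' - μ|) := by nlinarith [mul_nonneg hM0 (abs_nonneg (μ' - μ))]
      _ ≤ _ := by gcongr
  rw [div_mul_eq_mul_div, le_div_iff₀ h0, mul_comm]
  exact (mul_le_mul_of_nonneg_right h2 (abs_nonneg _)).trans h4

/-- The linear approximation of a smoothed function, with the derivatives of Bonnet and Price. -/
theorem abs_smooth_sub_sub_le (hlam : 0 < lam) (hψ : Differentiable ℝ ψ)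
    (hψ' : Differentiable ℝ (deriv ψ)) (hM : ∀ x, |ψ x| ≤ M)
    (hM' : ∀ x, |deriv ψ x| ≤ M) (hM'' : ∀ x, |deriv (deriv ψ) x| ≤ M)
    {μ v μ' v' : ℝ} (hv : lam ≤ v) (hv' : lam ≤ v') :
    |smooth ψ μ' v' - smooth ψ μ v - (smooth (deriv ψ) μ v * (μ' - μ) +
        smooth (deriv (deriv ψ)) μ v * (1 / 2 * (v' - v)))| ≤
      2 * M * ((v' - v) ^ 2 / lam + (μ' - μ) ^ 2) := by
  have hM0 : 0 ≤ M := (abs_nonneg _).trans (hM 0)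
  have hv0 := hlam.le.trans hv
  have hv0' := hlam.le.trans hv'
  have m0 := hψ.continuous.measurable
  have m1 := hψ'.continuous.measurable
  have i0 := integrable_comp_affine m0 hM (√v) μ
  have i0' := integrable_comp_affine m0 hM (√v') μ'
  have i1 := integrable_comp_affine m1 hM' (√v) μ
  have i2 := integrable_comp_affine_mul_id m1 hM' (√v) μ
  have hst := integral_comp_affine_mul_id hψ' hM' hM'' (√v) μ
  set σ := √v with hσ
  set σ' := √v' with hσ'
  -- The first order term in the increment of `σ ε + μ`; Stein's identity turns the part with `ε`
  -- into the smoothed second derivative.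
  have hlin : ∫ ε, deriv ψ (σ * ε + μ) * ((σ' - σ) * ε + (μ' - μ)) ∂(gaussianReal 0 1) =
      (σ' - σ) * (σ * smooth (deriv (deriv ψ)) μ v) + (μ' - μ) * smooth (deriv ψ) μ v := by
    have : ∀ ε, deriv ψ (σ * ε + μ) * ((σ' - σ) * ε + (μ' - μ)) =
      (σ' - σ) * (deriv ψ (σ * ε + μ) * ε) + (μ' - μ) * deriv ψ (σ * ε + μ) := fun ε => by ring
    simp_rw [this]
    rw [integral_add (i2.const_mul _) (i1.const_mul _), integral_const_mul, integral_const_mul,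
      hst]
    rfl
  have hilin : Integrable (fun ε => deriv ψ (σ * ε + μ) * ((σ' - σ) * ε + (μ' - μ)))
      (gaussianReal 0 1) :=
    ((i2.const_mul (σ' - σ)).add (i1.const_mul (μ' - μ))).congr
      (ae_of_all _ fun ε => by simp only [Pi.add_apply]; ring)
  have hiq : Integrable (fun ε => M * ((σ' - σ) ^ 2 * ε ^ 2 + 2 * (σ' - σ) * (μ' - μ) * ε +
      (μ' - μ) ^ 2)) (gaussianReal 0 1) :=
    (((integrable_sq_stdGaussianReal.const_mul _).add
      (integrable_id_stdGaussianReal.const_mul _)).add (integrable_const _)).const_mul _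
  have hmain : |smooth ψ μ' v' - smooth ψ μ v -
      ((σ' - σ) * (σ * smooth (deriv (deriv ψ)) μ v) + (μ' - μ) * smooth (deriv ψ) μ v)| ≤
      M * ((σ' - σ) ^ 2 + (μ' - μ) ^ 2) := by
    rw [← hlin]
    unfold smooth
    rw [← integral_sub i0' i0, ← integral_sub (by exact i0'.sub i0) hilin]
    refine abs_integral_le_integral_abs.trans ?_
    refine (integral_mono ((i0'.sub i0).sub hilin).abs hiq fun ε => ?_).trans (le_of_eq ?_)
    · have := abs_sub_sub_deriv_mul_le hψ hψ' hM'' (σ * ε + μ) (σ' * ε + μ')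
      simp only
      convert! this using 1
      · simp only [Pi.sub_apply]
        congr 2
        ring
      · ring
    · have hi : Integrable (fun ε => (σ' - σ) ^ 2 * ε ^ 2 + 2 * (σ' - σ) * (μ' - μ) * ε)
          (gaussianReal 0 1) := (integrable_sq_stdGaussianReal.const_mul _).add
        (integrable_id_stdGaussianReal.const_mul _)
      rw [integral_const_mul, integral_add hi (integrable_const _),
        integral_add (integrable_sq_stdGaussianReal.const_mul _)
        (integrable_id_stdGaussianReal.const_mul _), integral_const_mul, integral_const_mul,
        integral_sq_stdGaussianReal, integral_id_gaussianReal]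
      simp
  -- Passage from the increment of `σ` to that of `v = σ ^ 2`, the source of the factor `1 / 2`. The
  -- correction is quadratic and joins the remainder.
  have hσσ : (σ' - σ) * σ = 1 / 2 * (v' - v) - 1 / 2 * (σ' - σ) ^ 2 := by
    have e1 := Real.sq_sqrt hv0
    have e2 := Real.sq_sqrt hv0'
    rw [← hσ] at e1
    rw [← hσ'] at e2
    nlinarith
  have hΔ : (σ' - σ) ^ 2 ≤ (v' - v) ^ 2 / lam := by
    have := sqrt_le_sqrt_of_le_abs hlam hv hv'
    calc (σ' - σ) ^ 2 = |σ' - σ| ^ 2 := (sq_abs _).symm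
      _ ≤ (|v' - v| / √lam) ^ 2 := by gcongr
      _ = _ := by rw [div_pow, sq_abs, Real.sq_sqrt hlam.le]
  have hS := abs_smooth_le (measurable_deriv (deriv ψ)) hM'' μ v
  set S := smooth (deriv (deriv ψ)) μ v
  set S1 := smooth (deriv ψ) μ v
  have e3 : smooth ψ μ' v' - smooth ψ μ v - (S1 * (μ' - μ) + S * (1 / 2 * (v' - v))) =
      (smooth ψ μ' v' - smooth ψ μ v - ((σ' - σ) * (σ * S) + (μ' - μ) * S1)) -
        1 / 2 * (σ' - σ) ^ 2 * S := by
    linear_combination S * hσσ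
  rw [e3]
  calc _ ≤ M * ((σ' - σ) ^ 2 + (μ' - μ) ^ 2) + 1 / 2 * (σ' - σ) ^ 2 * M := by
        refine (abs_sub _ _).trans (add_le_add hmain ?_)
        rw [abs_mul, abs_of_nonneg (by positivity : 0 ≤ 1 / 2 * (σ' - σ) ^ 2)]
        gcongr
    _ ≤ 2 * M * ((σ' - σ) ^ 2 + (μ' - μ) ^ 2) := by
        nlinarith [mul_nonneg hM0 (sq_nonneg (σ' - σ)), mul_nonneg hM0 (sq_nonneg (μ' - μ))]
    _ ≤ _ := by gcongr

end Smooth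

/-! ### Gaussian densities and the Kullback-Leibler divergence -/

section GaussianDensity

variable {ι : Type*} [Fintype ι]

theorem integrable_exp_sub_norm_sq_div_two (c : ℝ) :
    Integrable (fun x : EuclideanSpace ℝ ι => Real.exp (c - ‖x‖ ^ 2 / 2)) := by
  have h := (GaussianFourier.integrable_cexp_neg_mul_sq_norm_add (V := EuclideanSpace ℝ ι)
    (b := (1 / 2 : ℂ)) (by norm_num) 0 0).norm.const_mul (Real.exp c)
  refine h.congr (ae_of_all _ fun x => ?_)
  simp only [inner_zero_left, Complex.norm_exp]
  rw [← Real.exp_add]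
  congr 1
  have : (-(1 / 2 : ℂ) * (‖x‖ : ℂ) ^ 2 + 0 * ((0 : ℝ) : ℂ)) = ((-(1 / 2) * ‖x‖ ^ 2 : ℝ) : ℂ) := by
    push_cast
    ring
  rw [this, Complex.ofReal_re]
  ring

/-- The standard Gaussian measure has a density of the form `exp (c - ‖x‖ ^ 2 / 2)`. -/
theorem exists_stdGaussian_eq_withDensity : ∃ c : ℝ, stdGaussian (EuclideanSpace ℝ ι) =
    volume.withDensity fun x => ENNReal.ofReal (Real.exp (c - ‖x‖ ^ 2 / 2)) := by
  set n : ℕ := Module.finrank ℝ (EuclideanSpace ℝ ι) with hn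
  have hpos : 0 < (2 * Real.pi) ^ ((n : ℝ) / 2) := by positivity
  refine ⟨-Real.log ((2 * Real.pi) ^ ((n : ℝ) / 2)), ?_⟩
  set c := -Real.log ((2 * Real.pi) ^ ((n : ℝ) / 2)) with hc
  have hfin : IsFiniteMeasure ((volume : Measure (EuclideanSpace ℝ ι)).withDensity
      fun x => ENNReal.ofReal (Real.exp (c - ‖x‖ ^ 2 / 2))) :=
    isFiniteMeasure_withDensity_ofReal (integrable_exp_sub_norm_sq_div_two c).2
  -- Both measures are finite, so it suffices that the Fourier transform of the density is the
  -- Gaussian characteristic function; `c` is the logarithm of the normalizing constant.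
  refine Measure.ext_of_charFun ?_
  ext t
  rw [charFun_stdGaussian, charFun_apply, integral_withDensity_eq_integral_toReal_smul
    (by fun_prop) (ae_of_all _ fun _ => ENNReal.ofReal_lt_top)]
  have h1 : ∀ x : EuclideanSpace ℝ ι,
      (ENNReal.ofReal (Real.exp (c - ‖x‖ ^ 2 / 2))).toReal • Complex.exp (inner ℝ x t * Complex.I) =
        Complex.exp c * Complex.exp (-(1 / 2 : ℂ) * ‖x‖ ^ 2 + Complex.I * inner ℝ t x) := by
    intro x
    rw [ENNReal.toReal_ofReal (Real.exp_pos _).le, Complex.real_smul, Complex.ofReal_exp,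
      ← Complex.exp_add, ← Complex.exp_add, real_inner_comm]
    congr 1
    push_cast
    ring
  simp_rw [h1]
  rw [integral_const_mul, GaussianFourier.integral_cexp_neg_mul_sq_norm_add (by norm_num)]
  have h2 : Complex.exp c * ((Real.pi : ℂ) / (1 / 2)) ^ ((n : ℂ) / 2) = 1 := by
    have e1 : ((Real.pi : ℂ) / (1 / 2)) ^ ((n : ℂ) / 2) =
        (((2 * Real.pi) ^ ((n : ℝ) / 2) : ℝ) : ℂ) := by
      rw [Complex.ofReal_cpow (by positivity)]
      push_cast
      congr 1
      ring
    rw [e1, ← Complex.ofReal_exp, hc, Real.exp_neg, Real.exp_log hpos, ← Complex.ofReal_mul,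
      inv_mul_cancel₀ hpos.ne', Complex.ofReal_one]
  rw [← mul_assoc, h2, one_mul, Complex.I_sq]
  congr 1
  ring

theorem map_equiv_withDensity {α β : Type*} {mα : MeasurableSpace α} {mβ : MeasurableSpace β}
    (e : α ≃ᵐ β) (μ : Measure α) {f : β → ℝ≥0∞} :
    (μ.withDensity fun x => f (e x)).map e = (μ.map e).withDensity f := by
  ext s hs
  rw [Measure.map_apply e.measurable hs, withDensity_apply _ (e.measurable hs),
    withDensity_apply _ hs, e.restrict_map, lintegral_map_equiv]

theorem dotProduct_mulVec_eq_sum (A : Matrix ι ι ℝ) (x : ι → ℝ) :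
    x ⬝ᵥ (A *ᵥ x) = ∑ i, ∑ j, A i j * (x i * x j) := by
  simp only [dotProduct, Matrix.mulVec, Finset.mul_sum]
  exact Finset.sum_congr rfl fun i _ => Finset.sum_congr rfl fun j _ => by ring

variable [DecidableEq ι]

/-- The logarithm of the density of `N(m, V)`, up to an additive constant `c`. -/
def logDensity (c : ℝ) (m : EuclideanSpace ℝ ι) (V : Matrix ι ι ℝ) (x : EuclideanSpace ℝ ι) : ℝ :=
  c - 1 / 2 * Real.log V.det - 1 / 2 * ((x - m).ofLp ⬝ᵥ (V⁻¹ *ᵥ (x - m).ofLp))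

@[fun_prop]
theorem continuous_logDensity (c : ℝ) (m : EuclideanSpace ℝ ι) (V : Matrix ι ι ℝ) :
    Continuous (logDensity c m V) := by
  unfold logDensity
  simp only [dotProduct, Matrix.mulVec]
  fun_prop

open scoped MatrixOrder in
/-- The density of the multivariate Gaussian measure with a positive definite covariance. -/
theorem exists_multivariateGaussian_eq_withDensity :
    ∃ c : ℝ, ∀ (m : EuclideanSpace ℝ ι) {V : Matrix ι ι ℝ}, V.PosDef →
      multivariateGaussian m V = volume.withDensity fun x =>
        ENNReal.ofReal (Real.exp (logDensity c m V x)) := by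
  obtain ⟨c, hc⟩ := exists_stdGaussian_eq_withDensity (ι := ι)
  -- The constant of the standard Gaussian serves for all `m` and `V`; this uniformity lets it
  -- cancel in log-likelihood ratios.
  refine ⟨c, fun m V hV => ?_⟩
  set R : Matrix ι ι ℝ := CFC.sqrt V with hR
  have hRR : R * R = V := CFC.sqrt_mul_sqrt_self V hV.posSemidef.nonneg
  have hRT : Rᵀ = R := by
    have : IsSelfAdjoint R := (CFC.sqrt_nonneg V).isSelfAdjoint
    simpa [IsSelfAdjoint, Matrix.star_eq_conjTranspose] using this
  have hdet : R.det ^ 2 = V.det := by rw [← hRR, Matrix.det_mul, sq]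
  have hdet0 : R.det ≠ 0 := by
    intro h
    have := hV.det_pos
    rw [← hdet, h] at this
    simp at this
  have hunit : IsUnit R.det := isUnit_iff_ne_zero.2 hdet0
  have hquad : ∀ y : ι → ℝ, (R⁻¹ *ᵥ y) ⬝ᵥ (R⁻¹ *ᵥ y) = y ⬝ᵥ (V⁻¹ *ᵥ y) := by
    intro y
    rw [← hRR, Matrix.mul_inv_rev, ← Matrix.mulVec_mulVec, Matrix.dotProduct_mulVec,
      Matrix.dotProduct_mulVec, ← Matrix.mulVec_transpose (R⁻¹) y, Matrix.transpose_nonsing_inv,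
      hRT, ← Matrix.dotProduct_mulVec]
  let T := Matrix.toEuclideanCLM (n := ι) (𝕜 := ℝ)
  have hinv1 : ∀ x, T R⁻¹ (T R x) = x := by
    intro x
    have : T R⁻¹ * T R = 1 := by rw [← map_mul, Matrix.nonsing_inv_mul _ hunit, map_one]
    simpa using congrArg (fun f => f x) this
  have hinv2 : ∀ x, T R (T R⁻¹ x) = x := by
    intro x
    have : T R * T R⁻¹ = 1 := by rw [← map_mul, Matrix.mul_nonsing_inv _ hunit, map_one]
    simpa using congrArg (fun f => f x) this
  let e : EuclideanSpace ℝ ι ≃ᵐ EuclideanSpace ℝ ι :=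
    { toFun := fun x => m + T R x
      invFun := fun y => T R⁻¹ (y - m)
      left_inv := fun x => by simp [hinv1]
      right_inv := fun y => by simp [hinv2]
      measurable_toFun := by
        change Measurable fun x => m + T R x
        fun_prop
      measurable_invFun := by
        change Measurable fun y => T R⁻¹ (y - m)
        fun_prop }
  have he : ∀ x, e x = m + T R x := fun _ => rfl
  -- The affine map `x ↦ m + R x` carries the standard Gaussian to `N(m, V)` and scales volume by
  -- the inverse of `|det R| = √(det V)`.
  have hvol : (volume : Measure (EuclideanSpace ℝ ι)).map e =
      ENNReal.ofReal |R.det⁻¹| • volume := by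
    have h1 : (e : EuclideanSpace ℝ ι → EuclideanSpace ℝ ι) =
      (fun x => m + x) ∘ ((T R : EuclideanSpace ℝ ι →L[ℝ] EuclideanSpace ℝ ι) :
        EuclideanSpace ℝ ι →ₗ[ℝ] EuclideanSpace ℝ ι) := rfl
    have h2 : LinearMap.det ((T R : EuclideanSpace ℝ ι →L[ℝ] EuclideanSpace ℝ ι) :
        EuclideanSpace ℝ ι →ₗ[ℝ] EuclideanSpace ℝ ι) = R.det := by
      rw [Matrix.coe_toEuclideanCLM_eq_toEuclideanLin]
      exact LinearMap.det_toLpLin _ _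
    have h3 : Measurable ((T R : EuclideanSpace ℝ ι →L[ℝ] EuclideanSpace ℝ ι) :
        EuclideanSpace ℝ ι →ₗ[ℝ] EuclideanSpace ℝ ι) := (T R).measurable
    rw [h1, ← Measure.map_map (measurable_const_add m) h3,
      Measure.map_linearMap_addHaar_eq_smul_addHaar _ (by rw [h2]; exact hdet0), h2,
      Measure.map_smul, map_add_left_eq_self]
  have hdens : (fun x => ENNReal.ofReal (Real.exp (c - ‖x‖ ^ 2 / 2))) =
      fun x => ENNReal.ofReal (Real.exp (c - ‖e.symm (e x)‖ ^ 2 / 2)) := by simp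
  change (stdGaussian (EuclideanSpace ℝ ι)).map e = _
  rw [hc, hdens, map_equiv_withDensity e volume
    (f := fun y => ENNReal.ofReal (Real.exp (c - ‖e.symm y‖ ^ 2 / 2))), hvol,
    withDensity_smul_measure, ← withDensity_smul _ (by fun_prop)]
  congr 1
  ext y
  simp only [Pi.smul_apply, smul_eq_mul]
  rw [← ENNReal.ofReal_mul (abs_nonneg _)]
  congr 1
  have h3 : |R.det⁻¹| = Real.exp (-(1 / 2 * Real.log V.det)) := by
    rw [← hdet, Real.log_pow, abs_inv, ← Real.exp_log (abs_pos.2 hdet0), Real.log_abs,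
      ← Real.exp_neg]
    congr 1
    push_cast
    ring
  have h4 : ‖e.symm y‖ ^ 2 = (y - m).ofLp ⬝ᵥ (V⁻¹ *ᵥ (y - m).ofLp) := by
    rw [← hquad, EuclideanSpace.real_norm_sq_eq]
    simp only [dotProduct, ← sq]
    rfl
  rw [h3, h4, ← Real.exp_add]
  unfold logDensity
  congr 1
  ring

theorem integrable_apply_mul_apply_multivariateGaussian (m a : EuclideanSpace ℝ ι)
    (V : Matrix ι ι ℝ) (i j : ι) :
    Integrable (fun x => (x i - a i) * (x j - a j)) (multivariateGaussian m V) := by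
  have h : ∀ i, MemLp (fun x : EuclideanSpace ℝ ι => x i - a i) 2 (multivariateGaussian m V) :=
    fun i => ((EuclideanSpace.proj (𝕜 := ℝ) i).comp_memLp' IsGaussian.memLp_two_id).sub
      (memLp_const _)
  exact (h i).integrable_mul (h j)

theorem integral_apply_mul_apply_multivariateGaussian (m a : EuclideanSpace ℝ ι)
    {V : Matrix ι ι ℝ} (hV : V.PosSemidef) (i j : ι) :
    ∫ x, (x i - a i) * (x j - a j) ∂(multivariateGaussian m V) =
      V i j + (m i - a i) * (m j - a j) := by
  have hL : ∀ i, MemLp (fun x : EuclideanSpace ℝ ι => x i) 2 (multivariateGaussian m V) :=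
    fun i => (EuclideanSpace.proj (𝕜 := ℝ) i).comp_memLp' IsGaussian.memLp_two_id
  have hi : ∀ i, Integrable (fun x : EuclideanSpace ℝ ι => x i) (multivariateGaussian m V) :=
    fun i => (hL i).integrable (by norm_num)
  have hmean : ∀ i, ∫ x, x i ∂(multivariateGaussian m V) = m i := by
    intro i
    have := (EuclideanSpace.proj i : EuclideanSpace ℝ ι →L[ℝ] ℝ).integral_comp_id_comm
      (μ := multivariateGaussian m V) IsGaussian.integrable_id
    rw [integral_id_multivariateGaussian] at this
    exact this
  have hcov := covariance_eval_multivariateGaussian (μ := m) hV i j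
  rw [covariance_eq_sub (hL i) (hL j), hmean, hmean] at hcov
  have hij : Integrable (fun x : EuclideanSpace ℝ ι => x i * x j) (multivariateGaussian m V) :=
    (hL i).integrable_mul (hL j)
  have e : ∀ x : EuclideanSpace ℝ ι, (x i - a i) * (x j - a j) =
      x i * x j - (a j * x i + a i * x j - a i * a j) := fun x => by ring
  simp_rw [e]
  have i1 : Integrable (fun x : EuclideanSpace ℝ ι => a j * x i + a i * x j)
    (multivariateGaussian m V) := ((hi i).const_mul _).add ((hi j).const_mul _)
  have i2 : Integrable (fun x : EuclideanSpace ℝ ι => a j * x i + a i * x j - a i * a j)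
    (multivariateGaussian m V) := i1.sub (integrable_const _)
  rw [integral_sub hij i2, integral_sub i1 (integrable_const _),
    integral_add ((hi i).const_mul _) ((hi j).const_mul _), integral_const_mul,
    integral_const_mul, hmean, hmean]
  simp only [Pi.mul_apply] at hcov
  simp only [integral_const, probReal_univ, one_smul]
  linear_combination hcov

/-- The Frobenius inner product of two matrices. -/
def frob (A B : Matrix ι ι ℝ) : ℝ := ∑ i, ∑ j, A i j * B i j

theorem integrable_quadratic_multivariateGaussian (m a : EuclideanSpace ℝ ι)
    (V A : Matrix ι ι ℝ) :
    Integrable (fun x => (x - a).ofLp ⬝ᵥ (A *ᵥ (x - a).ofLp)) (multivariateGaussian m V) := by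
  simp only [dotProduct_mulVec_eq_sum]
  exact integrable_finsetSum _ fun i _ => integrable_finsetSum _ fun j _ =>
    (integrable_apply_mul_apply_multivariateGaussian m a V i j).const_mul _

/-- Expanding the form into entries, each entry contributes a covariance plus a product of mean
offsets. -/
theorem integral_quadratic_multivariateGaussian (m a : EuclideanSpace ℝ ι)
    {V : Matrix ι ι ℝ} (hV : V.PosSemidef) (A : Matrix ι ι ℝ) :
    ∫ x, (x - a).ofLp ⬝ᵥ (A *ᵥ (x - a).ofLp) ∂(multivariateGaussian m V) =
      frob A V + (m - a).ofLp ⬝ᵥ (A *ᵥ (m - a).ofLp) := by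
  have hi : ∀ i j, Integrable (fun x : EuclideanSpace ℝ ι =>
      A i j * ((x - a).ofLp i * (x - a).ofLp j)) (multivariateGaussian m V) :=
    fun i j => (integrable_apply_mul_apply_multivariateGaussian m a V i j).const_mul (A i j)
  simp only [dotProduct_mulVec_eq_sum]
  rw [integral_finsetSum _ fun i _ => integrable_finsetSum _ fun j _ => hi i j]
  simp_rw [integral_finsetSum _ fun j _ => hi _ j, integral_const_mul]
  unfold frob
  rw [← Finset.sum_add_distrib]
  refine Finset.sum_congr rfl fun i _ => ?_
  rw [← Finset.sum_add_distrib]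
  refine Finset.sum_congr rfl fun j _ => ?_
  have := integral_apply_mul_apply_multivariateGaussian m a hV i j
  simp only [PiLp.sub_apply]
  rw [this]
  ring

theorem frob_inv_self {V : Matrix ι ι ℝ} (hV : V.PosDef) : frob V⁻¹ V = Fintype.card ι := by
  have hT : Vᵀ = V := by simpa using hV.isHermitian.eq
  have h1 : frob V⁻¹ V = (V⁻¹ * Vᵀ).trace := by
    simp [frob, Matrix.trace, Matrix.mul_apply]
  rw [h1, hT, Matrix.nonsing_inv_mul _ (isUnit_iff_ne_zero.2 hV.det_pos.ne'), Matrix.trace_one]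

/-- The Kullback-Leibler divergence between Gaussian measures. -/
theorem toReal_klDiv_multivariateGaussian (m m₀ : EuclideanSpace ℝ ι) {V K : Matrix ι ι ℝ}
    (hV : V.PosDef) (hK : K.PosDef) :
    (InformationTheory.klDiv (multivariateGaussian m V) (multivariateGaussian m₀ K)).toReal =
      1 / 2 * (frob K⁻¹ V + (m - m₀).ofLp ⬝ᵥ (K⁻¹ *ᵥ (m - m₀).ofLp) - Fintype.card ι +
        Real.log K.det - Real.log V.det) := by
  obtain ⟨c, hc⟩ := exists_multivariateGaussian_eq_withDensity (ι := ι)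
  set μ := multivariateGaussian m V with hμ
  set ν := multivariateGaussian m₀ K with hν
  have hμd : μ = volume.withDensity _ := hc m hV
  have hνd : ν = volume.withDensity _ := hc m₀ hK
  have meas : ∀ m (V : Matrix ι ι ℝ),
      Measurable fun x => ENNReal.ofReal (Real.exp (logDensity c m V x)) :=
    fun m V => by fun_prop
  have hne : ∀ m (V : Matrix ι ι ℝ) x, ENNReal.ofReal (Real.exp (logDensity c m V x)) ≠ 0 :=
    fun m V x => by simp [Real.exp_pos]
  have hμvol : μ ≪ volume := by
    rw [hμd]
    exact withDensity_absolutelyContinuous _ _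
  have hvolν : volume ≪ ν := by
    rw [hνd]
    exact withDensity_absolutelyContinuous' (meas _ _).aemeasurable (ae_of_all _ (hne _ _))
  have hrn : μ.rnDeriv ν =ᵐ[volume] fun x =>
      ENNReal.ofReal (Real.exp (logDensity c m V x - logDensity c m₀ K x)) := by
    have h1 : μ.rnDeriv ν =ᵐ[volume] fun x =>
        (ENNReal.ofReal (Real.exp (logDensity c m₀ K x)))⁻¹ * μ.rnDeriv volume x := by
      rw [hνd]
      exact Measure.rnDeriv_withDensity_right _ _ (meas _ _).aemeasurable (ae_of_all _ (hne _ _))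
        (ae_of_all _ fun _ => ENNReal.ofReal_ne_top)
    have h2 : μ.rnDeriv volume =ᵐ[volume] fun x =>
        ENNReal.ofReal (Real.exp (logDensity c m V x)) := by
      rw [hμd]
      exact Measure.rnDeriv_withDensity _ (meas _ _)
    filter_upwards [h1, h2] with x hx1 hx2
    rw [hx1, hx2, ← ENNReal.ofReal_inv_of_pos (Real.exp_pos _),
      ← ENNReal.ofReal_mul (by positivity),
      ← Real.exp_neg, ← Real.exp_add]
    congr 2
    ring
  have hllr : llr μ ν =ᵐ[μ] fun x => logDensity c m V x - logDensity c m₀ K x := by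
    filter_upwards [hμvol.ae_le hrn] with x hx
    rw [llr, hx, ENNReal.toReal_ofReal (Real.exp_pos _).le, Real.log_exp]
  -- For equal total masses the divergence is the plain integral of the log-likelihood ratio, here a
  -- difference of two quadratic forms plus a constant.
  rw [InformationTheory.toReal_klDiv_of_measure_eq (hμvol.trans hvolν) (by simp [hμ, hν]),
    integral_congr_ae hllr]
  have i1 := (integrable_quadratic_multivariateGaussian m m V V⁻¹).const_mul (1 / 2)
  have i2 := (integrable_quadratic_multivariateGaussian m m₀ V K⁻¹).const_mul (1 / 2)
  have e : ∀ x, logDensity c m V x - logDensity c m₀ K x =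
      (1 / 2 * (Real.log K.det - Real.log V.det) +
        1 / 2 * ((x - m₀).ofLp ⬝ᵥ (K⁻¹ *ᵥ (x - m₀).ofLp))) -
        1 / 2 * ((x - m).ofLp ⬝ᵥ (V⁻¹ *ᵥ (x - m).ofLp)) := fun x => by
    unfold logDensity
    ring
  simp_rw [e]
  have i3 : Integrable (fun x => 1 / 2 * (Real.log K.det - Real.log V.det) +
      1 / 2 * ((x - m₀).ofLp ⬝ᵥ (K⁻¹ *ᵥ (x - m₀).ofLp))) μ := (integrable_const _).add i2
  rw [integral_sub i3 i1, integral_add (integrable_const _) i2,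
    integral_const_mul, integral_const_mul, integral_const_mul, hμ,
    integral_quadratic_multivariateGaussian m m hV.posSemidef,
    integral_quadratic_multivariateGaussian m m₀ hV.posSemidef, frob_inv_self hV]
  simp
  ring

/-- The tangent line bound for the concave function `log det`. -/
theorem log_det_sub_log_det_le {V W : Matrix ι ι ℝ} (hV : V.PosDef) (hW : W.PosDef) :
    Real.log W.det - Real.log V.det ≤ frob V⁻¹ (W - V) := by
  -- Concavity without differentiating the determinant: the inequality is nonnegativity of the
  -- divergence of `N(0, W)` from `N(0, V)`.
  have h := toReal_klDiv_multivariateGaussian (0 : EuclideanSpace ℝ ι) 0 hW hV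
  have h0 : 0 ≤ (InformationTheory.klDiv (multivariateGaussian (0 : EuclideanSpace ℝ ι) W)
    (multivariateGaussian 0 V)).toReal := ENNReal.toReal_nonneg
  have h1 : frob V⁻¹ (W - V) = frob V⁻¹ W - Fintype.card ι := by
    rw [← frob_inv_self hV]
    simp [frob, mul_sub]
  rw [h] at h0
  simp at h0
  linarith

end GaussianDensity

/-! ### Symmetric matrices and smoothness of the KL term -/

section SymmetricMatrices

variable {k : ℕ}

/-- The symmetric part of a matrix, vectorized. -/
def toSym (A : Matrix (Fin k) (Fin k) ℝ) : SymMat k :=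
  ⟨WithLp.toLp 2 fun ij => (A ij.1 ij.2 + A ij.2 ij.1) / 2, fun i j => by simp [add_comm]⟩

/-- The matrix of a vectorized symmetric matrix. -/
def matOf (H : SymMat k) : Matrix (Fin k) (Fin k) ℝ :=
  Matrix.of fun i j => (H : EuclideanSpace ℝ (Fin k × Fin k)) (i, j)

theorem matOf_symm (H : SymMat k) (i j : Fin k) : (matOf H) i j = (matOf H) j i := H.2 i j

theorem toSym_sub (A B : Matrix (Fin k) (Fin k) ℝ) : toSym (A - B) = toSym A - toSym B := by
  ext ij
  simp [toSym]
  ring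

theorem norm_sq_eq_frob (H : SymMat k) : ‖H‖ ^ 2 = frob (matOf H) (matOf H) := by
  rw [← Submodule.norm_coe, EuclideanSpace.real_norm_sq_eq, Fintype.sum_prod_type]
  simp [frob, matOf, sq]

/-- A symmetric direction does not see the antisymmetric part of `A`. Thus `toSym` converts a
Frobenius derivative into a gradient in the parameter space. -/
theorem inner_toSym (A : Matrix (Fin k) (Fin k) ℝ) (H : SymMat k) :
    inner ℝ (toSym A) H = frob A (matOf H) := by
  have h1 : inner ℝ (toSym A) H = ∑ i, ∑ j, (A i j + A j i) / 2 * (matOf H) i j := by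
    rw [Submodule.coe_inner, PiLp.inner_apply, Fintype.sum_prod_type]
    refine Finset.sum_congr rfl fun i _ => Finset.sum_congr rfl fun j _ => ?_
    simp [toSym, matOf, mul_comm]
  have h2 : ∑ i, ∑ j, A j i * (matOf H) i j = ∑ i, ∑ j, A i j * (matOf H) i j := by
    rw [Finset.sum_comm]
    exact Finset.sum_congr rfl fun i _ => Finset.sum_congr rfl fun j _ => by rw [matOf_symm H]
  have h3 : ∑ i, ∑ j, (A i j + A j i) / 2 * (matOf H) i j =
      1 / 2 * ∑ i, ∑ j, A i j * (matOf H) i j + 1 / 2 * ∑ i, ∑ j, A j i * (matOf H) i j := by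
    simp only [Finset.mul_sum, ← Finset.sum_add_distrib]
    exact Finset.sum_congr rfl fun i _ => Finset.sum_congr rfl fun j _ => by ring
  rw [h1, h3, h2, frob]
  ring

theorem inner_smul_toSym (c : ℝ) (A : Matrix (Fin k) (Fin k) ℝ) (H : SymMat k) :
    inner ℝ (c • toSym A) H = c * frob A (matOf H) := by
  rw [← inner_toSym]
  exact real_inner_smul_left (toSym A) H c

theorem matOf_sub (H H' : SymMat k) : matOf (H' - H) = matOf H' - matOf H := by
  ext i j
  simp [matOf]

theorem Param.V_eq_matOf (r : Param k) : r.V = matOf r.snd := rfl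

theorem norm_toSym_sq_le (A : Matrix (Fin k) (Fin k) ℝ) : ‖toSym A‖ ^ 2 ≤ frob A A := by
  rw [norm_sq_eq_frob]
  have h2 : ∑ i, ∑ j, A j i * A j i = ∑ i, ∑ j, A i j * A i j := Finset.sum_comm
  have h3 : frob A A = ∑ i, ∑ j, (1 / 2 * (A i j * A i j) + 1 / 2 * (A j i * A j i)) := by
    simp only [Finset.sum_add_distrib, ← Finset.mul_sum]
    rw [h2, frob]
    ring
  rw [h3, frob]
  refine Finset.sum_le_sum fun i _ => Finset.sum_le_sum fun j _ => ?_
  simp only [matOf, toSym, Matrix.of_apply]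
  nlinarith [sq_nonneg (A i j - A j i)]

open scoped Matrix.Norms.Frobenius in
theorem frob_mul_self_le (A B : Matrix (Fin k) (Fin k) ℝ) :
    frob (A * B) (A * B) ≤ frob A A * frob B B := by
  have h : ∀ A : Matrix (Fin k) (Fin k) ℝ, frob A A = ‖A‖ ^ 2 := by
    intro A
    rw [Matrix.frobenius_norm_def, ← Real.sqrt_eq_rpow, Real.sq_sqrt (by positivity)]
    simp [frob, sq]
  rw [h, h, h, ← mul_pow]
  gcongr
  exact Matrix.frobenius_norm_mul A B

section Loewner

variable {lam : ℝ} {V W : Matrix (Fin k) (Fin k) ℝ}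

theorem posDef_of_sub_posSemidef (hlam : 0 < lam)
    (hV : (V - lam • (1 : Matrix (Fin k) (Fin k) ℝ)).PosSemidef) : V.PosDef := by
  have h : (lam • (1 : Matrix (Fin k) (Fin k) ℝ)).PosDef := Matrix.PosDef.one.smul hlam
  simpa using h.posSemidef_add hV

theorem mul_dotProduct_self_le (hV : (V - lam • (1 : Matrix (Fin k) (Fin k) ℝ)).PosSemidef)
    (x : Fin k → ℝ) : lam * (x ⬝ᵥ x) ≤ x ⬝ᵥ (V *ᵥ x) := by
  have h := hV.dotProduct_mulVec_nonneg x
  simp only [star_trivial, Matrix.sub_mulVec, dotProduct_sub, Matrix.smul_mulVec,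
    Matrix.one_mulVec, dotProduct_smul, smul_eq_mul] at h
  linarith

/-- The column `x = V⁻¹ e_j` satisfies `lam * |x|² ≤ x ⬝ V x = x_j`. Comparing with the coordinate
`j` gives `x_j ≤ 1 / lam`, and then every coordinate is bounded. -/
theorem abs_inv_apply_le (hlam : 0 < lam)
    (hV : (V - lam • (1 : Matrix (Fin k) (Fin k) ℝ)).PosSemidef) (i j : Fin k) :
    V⁻¹ i j ^ 2 ≤ (1 / lam) ^ 2 := by
  have hpd := posDef_of_sub_posSemidef hlam hV
  set x : Fin k → ℝ := V⁻¹ *ᵥ Pi.single j 1 with hx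
  have hxi : ∀ i, x i = V⁻¹ i j := fun i => by simp [hx]
  have hVx : V *ᵥ x = Pi.single j 1 := by
    rw [hx, Matrix.mulVec_mulVec, Matrix.mul_nonsing_inv _ (isUnit_iff_ne_zero.2 hpd.det_pos.ne'),
      Matrix.one_mulVec]
  have h1 := mul_dotProduct_self_le hV x
  rw [hVx, dotProduct_single, mul_one] at h1
  have h2 : ∀ i, x i ^ 2 ≤ x ⬝ᵥ x := fun i => by
    rw [dotProduct, sq]
    exact Finset.single_le_sum (f := fun i => x i * x i) (fun i _ => mul_self_nonneg _)
      (Finset.mem_univ i)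
  have h3 : lam * x j ^ 2 ≤ x j := (mul_le_mul_of_nonneg_left (h2 j) hlam.le).trans h1
  have h4 : lam * x i ^ 2 ≤ x j := (mul_le_mul_of_nonneg_left (h2 i) hlam.le).trans h1
  have h5 : x j ≤ 1 / lam := by
    rw [le_div_iff₀ hlam]
    have : 0 ≤ x j := (mul_nonneg hlam.le (sq_nonneg _)).trans h3
    rcases this.eq_or_lt with h | h
    · rw [← h]
      norm_num
    · nlinarith
  rw [← hxi]
  calc x i ^ 2 = (lam * x i ^ 2) / lam := by field_simp
    _ ≤ (1 / lam) / lam := by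
        gcongr
        exact h4.trans h5
    _ = (1 / lam) ^ 2 := by ring

theorem frob_inv_le (hlam : 0 < lam)
    (hV : (V - lam • (1 : Matrix (Fin k) (Fin k) ℝ)).PosSemidef) :
    frob V⁻¹ V⁻¹ ≤ (k / lam) ^ 2 := by
  calc frob V⁻¹ V⁻¹ ≤ ∑ _i : Fin k, ∑ _j : Fin k, (1 / lam) ^ 2 := by
        refine Finset.sum_le_sum fun i _ => Finset.sum_le_sum fun j _ => ?_
        rw [← sq]
        exact abs_inv_apply_le hlam hV i j
    _ = (k / lam) ^ 2 := by
        simp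
        ring

/-- Resolvent identity `V⁻¹ - W⁻¹ = V⁻¹ (W - V) W⁻¹` and submultiplicativity of the Frobenius norm.
-/
theorem frob_inv_sub_inv_le (hlam : 0 < lam)
    (hV : (V - lam • (1 : Matrix (Fin k) (Fin k) ℝ)).PosSemidef)
    (hW : (W - lam • (1 : Matrix (Fin k) (Fin k) ℝ)).PosSemidef) :
    frob (V⁻¹ - W⁻¹) (V⁻¹ - W⁻¹) ≤ ((k / lam) ^ 2) ^ 2 * frob (W - V) (W - V) := by
  have uV := isUnit_iff_ne_zero.2 (posDef_of_sub_posSemidef hlam hV).det_pos.ne'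
  have uW := isUnit_iff_ne_zero.2 (posDef_of_sub_posSemidef hlam hW).det_pos.ne'
  have e : V⁻¹ - W⁻¹ = V⁻¹ * (W - V) * W⁻¹ := by
    rw [mul_sub, Matrix.nonsing_inv_mul _ uV, sub_mul, mul_assoc, Matrix.mul_nonsing_inv _ uW,
      mul_one, one_mul]
  have hn : ∀ A : Matrix (Fin k) (Fin k) ℝ, 0 ≤ frob A A := fun A =>
    Finset.sum_nonneg fun i _ => Finset.sum_nonneg fun j _ => mul_self_nonneg _
  rw [e]
  calc _ ≤ frob (V⁻¹ * (W - V)) (V⁻¹ * (W - V)) * frob W⁻¹ W⁻¹ := frob_mul_self_le _ _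
    _ ≤ (frob V⁻¹ V⁻¹ * frob (W - V) (W - V)) * frob W⁻¹ W⁻¹ := by
        gcongr
        · exact hn _
        · exact frob_mul_self_le _ _
    _ ≤ ((k / lam) ^ 2 * frob (W - V) (W - V)) * (k / lam) ^ 2 := by
        exact mul_le_mul (mul_le_mul_of_nonneg_right (frob_inv_le hlam hV) (hn _))
          (frob_inv_le hlam hW) (hn _) (mul_nonneg (sq_nonneg _) (hn _))
    _ = _ := by ring

end Loewner

theorem norm_toSym_inv_sub_inv_le {lam : ℝ} (hlam : 0 < lam) {H H' : SymMat k}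
    (hH : ((matOf H) - lam • (1 : Matrix (Fin k) (Fin k) ℝ)).PosSemidef)
    (hH' : ((matOf H') - lam • (1 : Matrix (Fin k) (Fin k) ℝ)).PosSemidef) :
    ‖toSym ((matOf H)⁻¹ - (matOf H')⁻¹)‖ ≤ (k / lam) ^ 2 * ‖H' - H‖ := by
  refine le_of_sq_le_sq ?_ (by positivity)
  refine (norm_toSym_sq_le _).trans ((frob_inv_sub_inv_le hlam hH hH').trans (le_of_eq ?_))
  rw [mul_pow, norm_sq_eq_frob]
  rfl

namespace Model

variable {Y : Type*} {n : ℕ} (D : Model Y n k)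

/-- The gradient of `kl` at the parameters with a positive definite covariance. -/
def klGradient (r : Param k) : Param k :=
  WithLp.toLp 2 (Matrix.toEuclideanCLM (𝕜 := ℝ) D.K₀⁻¹ (r.fst - D.m₀),
    (1 / 2 : ℝ) • toSym (D.K₀⁻¹ - r.V⁻¹))

theorem klGradient_fst (r : Param k) : (D.klGradient r).fst =
    Matrix.toEuclideanCLM (𝕜 := ℝ) D.K₀⁻¹ (r.fst - D.m₀) := rfl

theorem klGradient_snd (r : Param k) : (D.klGradient r).snd =
    (1 / 2 : ℝ) • toSym (D.K₀⁻¹ - r.V⁻¹) := rfl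

theorem kl_nonneg (r : Param k) : 0 ≤ D.kl r := ENNReal.toReal_nonneg

theorem norm_sq_eq_add (x : Param k) : ‖x‖ ^ 2 = ‖x.fst‖ ^ 2 + ‖x.snd‖ ^ 2 :=
  WithLp.prod_norm_sq_eq_of_L2 x

theorem norm_fst_le (x : Param k) : ‖x.fst‖ ≤ ‖x‖ := by
  refine le_of_sq_le_sq ?_ (norm_nonneg _)
  rw [norm_sq_eq_add]
  exact le_add_of_nonneg_right (sq_nonneg _)

theorem norm_snd_le (x : Param k) : ‖x.snd‖ ≤ ‖x‖ := by
  refine le_of_sq_le_sq ?_ (norm_nonneg _)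
  rw [norm_sq_eq_add]
  exact le_add_of_nonneg_left (sq_nonneg _)

theorem norm_le_add (x : Param k) : ‖x‖ ≤ ‖x.fst‖ + ‖x.snd‖ := by
  refine le_of_sq_le_sq ?_ (by positivity)
  rw [norm_sq_eq_add]
  nlinarith [mul_nonneg (norm_nonneg x.fst) (norm_nonneg x.snd)]

/-- The gradient is affine in the mean and depends on the covariance only through `V⁻¹`. -/
theorem klGradient_lipschitz {lam : ℝ} (hlam : 0 < lam) {r r' : Param k}
    (hr : (r.V - lam • (1 : Matrix (Fin k) (Fin k) ℝ)).PosSemidef)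
    (hr' : (r'.V - lam • (1 : Matrix (Fin k) (Fin k) ℝ)).PosSemidef) :
    ‖D.klGradient r' - D.klGradient r‖ ≤
      (‖Matrix.toEuclideanCLM (𝕜 := ℝ) D.K₀⁻¹‖ + (k / lam) ^ 2) * ‖r' - r‖ := by
  have h1 : (D.klGradient r' - D.klGradient r).fst =
      Matrix.toEuclideanCLM (𝕜 := ℝ) D.K₀⁻¹ (r' - r).fst := by
    rw [WithLp.sub_fst, klGradient_fst, klGradient_fst, ← map_sub, WithLp.sub_fst]
    congr 1
    abel
  have h2 : (D.klGradient r' - D.klGradient r).snd =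
      (1 / 2 : ℝ) • toSym (r.V⁻¹ - r'.V⁻¹) := by
    have e2 : toSym (r.V⁻¹ - r'.V⁻¹) = toSym (D.K₀⁻¹ - r'.V⁻¹) - toSym (D.K₀⁻¹ - r.V⁻¹) := by
      rw [← toSym_sub]
      congr 1
      abel
    rw [e2, smul_sub, WithLp.sub_snd, klGradient_snd, klGradient_snd]
  have h3 : ‖toSym (r.V⁻¹ - r'.V⁻¹)‖ ≤ (k / lam) ^ 2 * ‖(r' - r).snd‖ := by
      rw [WithLp.sub_snd]
      exact norm_toSym_inv_sub_inv_le hlam hr hr'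
  refine (norm_le_add _).trans ?_
  rw [h1, h2, norm_smul, add_mul]
  refine add_le_add ((ContinuousLinearMap.le_opNorm _ _).trans ?_) ?_
  · gcongr
    exact norm_fst_le _
  · calc ‖(1 / 2 : ℝ)‖ * ‖toSym (r.V⁻¹ - r'.V⁻¹)‖ ≤ 1 * ((k / lam) ^ 2 * ‖(r' - r).snd‖) := by
          gcongr
          norm_num
      _ ≤ _ := by
          rw [one_mul]
          gcongr
          exact norm_snd_le _

/-- The remainder consists of an exact quadratic form in the mean and the gap in the tangent
inequality for `log det`. The gap is nonnegative by the tangent at `r.V`; by the tangent at `r'.V`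
it is at most the pairing of `r.V⁻¹ - r'.V⁻¹` with `r'.V - r.V`, which is quadratic because
inversion is Lipschitz. -/
theorem abs_kl_sub_sub_le (hK : D.K₀.PosDef) {lam : ℝ} (hlam : 0 < lam) {r r' : Param k}
    (hr : (r.V - lam • (1 : Matrix (Fin k) (Fin k) ℝ)).PosSemidef)
    (hr' : (r'.V - lam • (1 : Matrix (Fin k) (Fin k) ℝ)).PosSemidef) :
    |D.kl r' - D.kl r - inner ℝ (D.klGradient r) (r' - r)| ≤
      (‖Matrix.toEuclideanCLM (𝕜 := ℝ) D.K₀⁻¹‖ + (k / lam) ^ 2) * ‖r' - r‖ ^ 2 := by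
  set T := Matrix.toEuclideanCLM (𝕜 := ℝ) D.K₀⁻¹ with hT
  have hV := posDef_of_sub_posSemidef hlam hr
  have hW := posDef_of_sub_posSemidef hlam hr'
  have hsa : ∀ x y, inner ℝ (T x) y = inner ℝ x (T y) := by
    intro x y
    have : IsSelfAdjoint T := IsSelfAdjoint.map (f := Matrix.toEuclideanCLM (𝕜 := ℝ))
      (Matrix.IsHermitian.inv hK.isHermitian)
    rw [← ContinuousLinearMap.adjoint_inner_right, this.adjoint_eq]
  have hq : ∀ x : EuclideanSpace ℝ (Fin k), x.ofLp ⬝ᵥ (D.K₀⁻¹ *ᵥ x.ofLp) = inner ℝ x (T x) :=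
    fun x => (Matrix.inner_toEuclideanCLM _ _ _).symm
  have hkl : ∀ r : Param k, r.V.PosDef → D.kl r = 1 / 2 * (frob D.K₀⁻¹ r.V +
      inner ℝ (r.fst - D.m₀) (T (r.fst - D.m₀)) - Fintype.card (Fin k) +
        Real.log D.K₀.det - Real.log r.V.det) := fun r hr => by
    rw [← hq]
    exact toReal_klDiv_multivariateGaussian _ _ hr hK
  have hin : inner ℝ (D.klGradient r) (r' - r) = inner ℝ (r.fst - D.m₀) (T (r' - r).fst) +
      1 / 2 * frob (D.K₀⁻¹ - r.V⁻¹) (r'.V - r.V) := by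
    rw [WithLp.prod_inner_apply]
    congr 1
    · exact hsa _ _
    · change inner ℝ ((1 / 2 : ℝ) • toSym (D.K₀⁻¹ - r.V⁻¹)) (r' - r).snd = _
      rw [inner_smul_toSym, WithLp.sub_snd, matOf_sub, r.V_eq_matOf, r'.V_eq_matOf]
  have hfs : ∀ A B C : Matrix (Fin k) (Fin k) ℝ, frob A (B - C) = frob A B - frob A C := by
    intro A B C
    simp [frob, mul_sub]
  have hfs' : ∀ A B C : Matrix (Fin k) (Fin k) ℝ, frob (A - B) C = frob A C - frob B C := by
    intro A B C
    simp [frob, sub_mul]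
  have hquad : inner ℝ (r'.fst - D.m₀) (T (r'.fst - D.m₀)) =
      inner ℝ (r.fst - D.m₀) (T (r.fst - D.m₀)) + 2 * inner ℝ (r.fst - D.m₀) (T (r' - r).fst) +
        inner ℝ (r' - r).fst (T (r' - r).fst) := by
    have e : r'.fst - D.m₀ = (r.fst - D.m₀) + (r' - r).fst := by
      simp
    rw [e, map_add, inner_add_left, inner_add_right, inner_add_right, ← hsa (r' - r).fst,
      real_inner_comm (T (r' - r).fst)]
    ring_nf
  set x := (r' - r).fst with hx
  have hmain : D.kl r' - D.kl r - inner ℝ (D.klGradient r) (r' - r) =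
      1 / 2 * inner ℝ x (T x) +
        1 / 2 * (frob r.V⁻¹ (r'.V - r.V) - (Real.log r'.V.det - Real.log r.V.det)) := by
    rw [hkl r' hW, hkl r hV, hin, hquad, hfs', hfs D.K₀⁻¹]
    ring
  have b1 : |inner ℝ x (T x)| ≤ ‖T‖ * ‖r' - r‖ ^ 2 := by
    refine (abs_real_inner_le_norm _ _).trans ?_
    calc ‖x‖ * ‖T x‖ ≤ ‖x‖ * (‖T‖ * ‖x‖) := by
          gcongr
          exact T.le_opNorm x
      _ = ‖T‖ * ‖x‖ ^ 2 := by ring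
      _ ≤ _ := by
          gcongr
          exact norm_fst_le _
  have l1 := log_det_sub_log_det_le hV hW
  have l2 := log_det_sub_log_det_le hW hV
  have l3 : frob (r.V⁻¹ - r'.V⁻¹) (r'.V - r.V) ≤ (k / lam) ^ 2 * ‖r' - r‖ ^ 2 := by
    have e : frob (r.V⁻¹ - r'.V⁻¹) (r'.V - r.V) =
      inner ℝ (toSym (r.V⁻¹ - r'.V⁻¹)) (r' - r).snd := by
      rw [inner_toSym, WithLp.sub_snd, matOf_sub, r.V_eq_matOf, r'.V_eq_matOf]
    rw [e]
    refine (real_inner_le_norm _ _).trans ?_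
    have h3 : ‖toSym (r.V⁻¹ - r'.V⁻¹)‖ ≤ (k / lam) ^ 2 * ‖(r' - r).snd‖ := by
        rw [WithLp.sub_snd]
        exact norm_toSym_inv_sub_inv_le hlam hr hr'
    calc _ ≤ (k / lam) ^ 2 * ‖(r' - r).snd‖ * ‖(r' - r).snd‖ := by gcongr
      _ = (k / lam) ^ 2 * ‖(r' - r).snd‖ ^ 2 := by ring
      _ ≤ _ := by
        gcongr
        exact norm_snd_le _
  have l4 : frob r'.V⁻¹ (r.V - r'.V) = - frob r'.V⁻¹ (r'.V - r.V) := by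
    rw [hfs, hfs]
    ring
  rw [hfs'] at l3
  rw [hmain, add_mul]
  refine (abs_add_le _ _).trans (add_le_add ?_ ?_)
  · rw [abs_mul, abs_of_pos (by norm_num : (0 : ℝ) < 1 / 2)]
    linarith [abs_nonneg (inner ℝ x (T x))]
  · rw [abs_of_nonneg (by linarith)]
    linarith

end Model

end SymmetricMatrices

/-! ### Calculus of quadratic approximations on a set -/

section QuadraticApproximation

variable {E : Type*} [NormedAddCommGroup E] [InnerProductSpace ℝ E] {S : Set E}

/-- On the set `S` the map `G` is Lipschitz and gives linear approximations of `f` with a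
quadratic remainder. -/
def SmoothOn (S : Set E) (f : E → ℝ) (G : E → E) : Prop :=
  ∃ C : ℝ, 0 ≤ C ∧ ∀ x ∈ S, ∀ y ∈ S,
    |f y - f x - inner ℝ (G x) (y - x)| ≤ C * ‖y - x‖ ^ 2 ∧ ‖G y - G x‖ ≤ C * ‖y - x‖

theorem SmoothOn.mono {T : Set E} {f : E → ℝ} {G : E → E} (h : SmoothOn T f G) (hST : S ⊆ T) :
    SmoothOn S f G := by
  obtain ⟨C, hC, h⟩ := h
  exact ⟨C, hC, fun x hx y hy => h x (hST hx) y (hST hy)⟩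

theorem SmoothOn.zero : SmoothOn S (fun _ => 0) fun _ => 0 :=
  ⟨0, le_rfl, fun x _ y _ => by simp⟩

theorem SmoothOn.add {f g : E → ℝ} {F G : E → E} (hf : SmoothOn S f F) (hg : SmoothOn S g G) :
    SmoothOn S (fun x => f x + g x) fun x => F x + G x := by
  obtain ⟨C, hC, h⟩ := hf
  obtain ⟨C', hC', h'⟩ := hg
  refine ⟨C + C', by positivity, fun x hx y hy => ⟨?_, ?_⟩⟩
  · rw [inner_add_left, add_mul]
    refine le_trans (le_of_eq ?_) ((abs_add_le _ _).trans
      (add_le_add (h x hx y hy).1 (h' x hx y hy).1))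
    congr 1
    ring
  · rw [add_mul, add_sub_add_comm]
    exact (norm_add_le _ _).trans (add_le_add (h x hx y hy).2 (h' x hx y hy).2)

theorem SmoothOn.const_mul {f : E → ℝ} {F : E → E} (c : ℝ) (hf : SmoothOn S f F) :
    SmoothOn S (fun x => c * f x) fun x => c • F x := by
  obtain ⟨C, hC, h⟩ := hf
  refine ⟨|c| * C, by positivity, fun x hx y hy => ⟨?_, ?_⟩⟩
  · rw [real_inner_smul_left, ← mul_sub, ← mul_sub, abs_mul, mul_assoc]
    exact mul_le_mul_of_nonneg_left (h x hx y hy).1 (abs_nonneg c)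
  · rw [← smul_sub, norm_smul, Real.norm_eq_abs, mul_assoc]
    exact mul_le_mul_of_nonneg_left (h x hx y hy).2 (abs_nonneg c)

theorem SmoothOn.sum {ι : Type*} (s : Finset ι) {f : ι → E → ℝ} {F : ι → E → E}
    (h : ∀ i, SmoothOn S (f i) (F i)) :
    SmoothOn S (fun x => ∑ i ∈ s, f i x) fun x => ∑ i ∈ s, F i x := by
  classical
  induction s using Finset.induction_on with
  | empty => simpa using SmoothOn.zero
  | insert a s ha ih =>
    simp only [Finset.sum_insert ha]
    exact (h a).add ih

/-- The inequality `log x ≤ x - 1`, used in both directions, puts `log b - log a` between `(b - a) /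
b` and `(b - a) / a`, an interval of length `(b - a)² / (a b)`. -/
theorem abs_log_sub_log_sub_le {ζ a b : ℝ} (hζ : 0 < ζ) (ha : ζ ≤ a) (hb : ζ ≤ b) :
    |Real.log b - Real.log a - (b - a) / a| ≤ (b - a) ^ 2 / ζ ^ 2 := by
  have ha0 := hζ.trans_le ha
  have hb0 := hζ.trans_le hb
  have key : ∀ {x y : ℝ}, 0 < x → 0 < y → Real.log y - Real.log x ≤ (y - x) / x := by
    intro x y hx hy
    rw [← Real.log_div hy.ne' hx.ne']
    refine (Real.log_le_sub_one_of_pos (by positivity)).trans (le_of_eq ?_)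
    field_simp
  have h1 := key ha0 hb0
  have h2 := key hb0 ha0
  have h3 : (b - a) / b = (b - a) / a - (b - a) ^ 2 / (a * b) := by
    field_simp
    ring
  have h4 : (b - a) ^ 2 / (a * b) ≤ (b - a) ^ 2 / ζ ^ 2 := by
    gcongr
    nlinarith
  have h5 : (a - b) / b = - ((b - a) / b) := by ring
  have h6 : 0 ≤ (b - a) ^ 2 / ζ ^ 2 := by positivity
  rw [abs_le]
  constructor <;> linarith

/-- Chain rule. The Lipschitz constant of `f` and the bound on `F` are separate hypotheses because
`S` may be unbounded, where a quadratic remainder yields neither. -/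
theorem SmoothOn.log {f : E → ℝ} {F : E → E} {ζ K M : ℝ} (hζ : 0 < ζ) (hf : SmoothOn S f F)
    (hlow : ∀ x ∈ S, ζ ≤ f x) (hlip : ∀ x ∈ S, ∀ y ∈ S, |f y - f x| ≤ K * ‖y - x‖)
    (hK : 0 ≤ K) (hM : ∀ x ∈ S, ‖F x‖ ≤ M) :
    SmoothOn S (fun x => Real.log (f x)) fun x => (f x)⁻¹ • F x := by
  obtain ⟨C, hC, h⟩ := hf
  refine ⟨C / ζ + K ^ 2 / ζ ^ 2 + |M| * K / ζ ^ 2, by positivity, fun x hx y hy => ⟨?_, ?_⟩⟩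
  · have hx0 := hζ.trans_le (hlow x hx)
    have h1 := abs_log_sub_log_sub_le hζ (hlow x hx) (hlow y hy)
    have h2 : (f y - f x) ^ 2 ≤ (K * ‖y - x‖) ^ 2 := by
      rw [← sq_abs]
      gcongr
      exact hlip x hx y hy
    have h3 : |(f y - f x - inner ℝ (F x) (y - x)) / f x| ≤ C * ‖y - x‖ ^ 2 / ζ := by
      rw [abs_div, abs_of_pos hx0]
      gcongr
      · exact (h x hx y hy).1
      · exact hlow x hx
    have e : Real.log (f y) - Real.log (f x) - inner ℝ ((f x)⁻¹ • F x) (y - x) =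
        (Real.log (f y) - Real.log (f x) - (f y - f x) / f x) +
          (f y - f x - inner ℝ (F x) (y - x)) / f x := by
      rw [real_inner_smul_left]
      field_simp
      ring
    rw [e]
    refine (abs_add_le _ _).trans ?_
    calc _ ≤ (K * ‖y - x‖) ^ 2 / ζ ^ 2 + C * ‖y - x‖ ^ 2 / ζ :=
          add_le_add (h1.trans (by gcongr)) h3
      _ = (C / ζ + K ^ 2 / ζ ^ 2 + 0) * ‖y - x‖ ^ 2 := by ring
      _ ≤ _ := by
          gcongr
          positivity
  · have hx0 := hζ.trans_le (hlow x hx)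
    have hy0 := hζ.trans_le (hlow y hy)
    have e : (f y)⁻¹ • F y - (f x)⁻¹ • F x =
        (f y)⁻¹ • (F y - F x) - ((f y - f x) / (f x * f y)) • F x := by
      have : (f y - f x) / (f x * f y) = (f x)⁻¹ - (f y)⁻¹ := by
        field_simp
      rw [this, smul_sub, sub_smul]
      abel
    rw [e]
    refine (norm_sub_le _ _).trans ?_
    rw [norm_smul, norm_smul, norm_inv, norm_div, Real.norm_of_nonneg hy0.le,
      Real.norm_of_nonneg (by positivity : 0 ≤ f x * f y), Real.norm_eq_abs]
    calc _ ≤ ζ⁻¹ * (C * ‖y - x‖) + (K * ‖y - x‖) / (ζ * ζ) * |M| := by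
          refine add_le_add (mul_le_mul ?_ (h x hx y hy).2 (norm_nonneg _) (by positivity))
            (mul_le_mul (div_le_div₀ (by positivity) (hlip x hx y hy) (by positivity)
              (mul_le_mul (hlow x hx) (hlow y hy) hζ.le hx0.le))
              ((hM x hx).trans (le_abs_self M)) (norm_nonneg _) (by positivity))
          exact inv_anti₀ hζ (hlow y hy)
      _ = (C / ζ + 0 + |M| * K / ζ ^ 2) * ‖y - x‖ := by
          field_simp
          ring
      _ ≤ _ := by
          gcongr
          positivity

theorem SmoothOn.hasGradientAt [CompleteSpace E] {f : E → ℝ} {G : E → E} {x : E}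
    (h : SmoothOn S f G) (hx : S ∈ 𝓝 x) : HasGradientAt f (G x) x := by
  obtain ⟨C, -, h⟩ := h
  refine hasGradientAt_of_quadratic (C := C) ?_
  filter_upwards [hx] with y hy
  exact (h x (mem_of_mem_nhds hx) y hy).1

end QuadraticApproximation

/-! ### Smoothness of the objective and its gradient -/

theorem norm_outer {k : ℕ} (a : EuclideanSpace ℝ (Fin k)) : ‖outer a‖ = ‖a‖ ^ 2 := by
  have h : ‖outer a‖ ^ 2 = (‖a‖ ^ 2) ^ 2 := by
    rw [← Submodule.norm_coe, EuclideanSpace.real_norm_sq_eq, EuclideanSpace.real_norm_sq_eq,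
      Fintype.sum_prod_type, sq (∑ i, a i ^ 2), Finset.sum_mul_sum]
    exact Finset.sum_congr rfl fun i _ => Finset.sum_congr rfl fun j _ => mul_pow _ _ _
  exact (pow_left_inj₀ (norm_nonneg _) (by positivity) two_ne_zero).1 h

theorem inner_outer {k : ℕ} (a : EuclideanSpace ℝ (Fin k)) (H : SymMat k) :
    inner ℝ (outer a) H = a.ofLp ⬝ᵥ (matOf H *ᵥ a.ofLp) := by
  rw [dotProduct_mulVec_eq_sum, Submodule.coe_inner, PiLp.inner_apply, Fintype.sum_prod_type]
  refine Finset.sum_congr rfl fun i _ => Finset.sum_congr rfl fun j _ => ?_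
  simp [outer, matOf]

namespace Model

variable {Y : Type*} {n k : ℕ} (D : Model Y n k)

/-- A bound on the likelihoods and their first two derivatives. -/
structure BoundedBy (M : ℝ) : Prop where
  differentiable : ∀ i, Differentiable ℝ (D.p (D.y i))
  differentiable_deriv : ∀ i, Differentiable ℝ (deriv (D.p (D.y i)))
  bound : ∀ i f, |D.p (D.y i) f| ≤ M
  bound' : ∀ i f, |deriv (D.p (D.y i)) f| ≤ M
  bound'' : ∀ i f, |deriv (deriv (D.p (D.y i))) f| ≤ M
  nonneg : 0 ≤ M

theorem DerivativeBounds.exists_boundedBy {D : Model Y n k} {B b' B' b'' B'' : ℝ}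
    (h : D.DerivativeBounds B b' B' b'' B'') : ∃ M, D.BoundedBy M := by
  have key : ∀ {x a b : ℝ}, a ≤ x → x ≤ b → |x| ≤ |a| + |b| := fun {x a b} h1 h2 =>
    abs_le.2 ⟨by linarith [neg_abs_le a, abs_nonneg b], by linarith [le_abs_self b, abs_nonneg a]⟩
  refine ⟨(|0| + |B|) + (|b'| + |B'|) + (|b''| + |B''|), h.differentiable, h.differentiable_deriv,
    fun i f => ?_, fun i f => ?_, fun i f => ?_, by positivity⟩
  · have := key (h.bound i f).1 (h.bound i f).2
    have : 0 ≤ |b'| + |B'| + (|b''| + |B''|) := by positivity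
    linarith
  · have := key (h.bound' i f).1 (h.bound' i f).2
    have : 0 ≤ |(0 : ℝ)| + |B| + (|b''| + |B''|) := by positivity
    linarith
  · have := key (h.bound'' i f).1 (h.bound'' i f).2
    have : 0 ≤ |(0 : ℝ)| + |B| + (|b'| + |B'|) := by positivity
    linarith

/-- The direction with coefficients `x` and `y` along `a_{i,1}` and `a_{i,2} a_{i,2}ᵀ / 2`. -/
def direction (i : Fin n) (x y : ℝ) : Param k :=
  WithLp.toLp 2 (x • D.a₁ i, y • ((1 / 2 : ℝ) • outer (D.a₂ i)))

theorem direction_sub (i : Fin n) (x y x' y' : ℝ) :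
    D.direction i x y - D.direction i x' y' = D.direction i (x - x') (y - y') := by
  unfold direction
  rw [sub_smul, sub_smul]
  rfl

theorem smul_direction (i : Fin n) (c x y : ℝ) :
    c • D.direction i x y = D.direction i (c * x) (c * y) := by
  unfold direction
  rw [mul_smul, mul_smul]
  rfl

/-- A bound on the size of the vectors of the model. -/
def scale (i : Fin n) : ℝ := ‖D.a₁ i‖ + ‖D.a₂ i‖ ^ 2

theorem scale_nonneg (i : Fin n) : 0 ≤ D.scale i := by
  unfold scale
  positivity

theorem norm_direction_le (i : Fin n) (x y : ℝ) :
    ‖D.direction i x y‖ ≤ D.scale i * (|x| + |y|) := by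
  refine (norm_le_add _).trans ?_
  have h1 : ‖(D.direction i x y).fst‖ = |x| * ‖D.a₁ i‖ := norm_smul _ _
  have h2 : ‖(D.direction i x y).snd‖ = |y| * (1 / 2 * ‖D.a₂ i‖ ^ 2) := by
    change ‖y • ((1 / 2 : ℝ) • outer (D.a₂ i))‖ = _
    rw [norm_smul, norm_smul, norm_outer, Real.norm_eq_abs,
      Real.norm_of_nonneg (by norm_num : (0 : ℝ) ≤ 1 / 2)]
  rw [h1, h2, scale]
  have e1 : 0 ≤ |x| * ‖D.a₂ i‖ ^ 2 := by positivity
  have e2 : 0 ≤ |y| * ‖D.a₁ i‖ := by positivity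
  have e3 : 0 ≤ |y| * ‖D.a₂ i‖ ^ 2 := by positivity
  nlinarith

theorem mean_sub (i : Fin n) (r r' : Param k) :
    D.mean i r' - D.mean i r = inner ℝ (D.a₁ i) (r' - r).fst := by
  have h : inner ℝ (D.a₁ i) (r' - r).fst =
      (D.a₁ i).ofLp ⬝ᵥ r'.m.ofLp - (D.a₁ i).ofLp ⬝ᵥ r.m.ofLp := by
    rw [WithLp.sub_fst, inner_sub_right]
    simp only [PiLp.inner_apply, dotProduct, Param.m]
    congr 1 <;> exact Finset.sum_congr rfl fun i _ => by simp [mul_comm]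
  rw [h, mean, mean]
  ring

theorem var_sub (i : Fin n) (r r' : Param k) :
    D.var i r' - D.var i r = inner ℝ (outer (D.a₂ i)) (r' - r).snd := by
  rw [inner_outer, WithLp.sub_snd, matOf_sub, Matrix.sub_mulVec, dotProduct_sub,
    ← Param.V_eq_matOf, ← Param.V_eq_matOf, var, var]
  ring

theorem abs_mean_sub_le (i : Fin n) (r r' : Param k) :
    |D.mean i r' - D.mean i r| ≤ D.scale i * ‖r' - r‖ := by
  rw [mean_sub]
  refine (abs_real_inner_le_norm _ _).trans ?_
  refine mul_le_mul ?_ (norm_fst_le _) (norm_nonneg _) (D.scale_nonneg i)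
  exact le_add_of_nonneg_right (by positivity)

theorem abs_var_sub_le (i : Fin n) (r r' : Param k) :
    |D.var i r' - D.var i r| ≤ D.scale i * ‖r' - r‖ := by
  rw [var_sub]
  refine (abs_real_inner_le_norm _ _).trans ?_
  rw [norm_outer]
  refine mul_le_mul ?_ (norm_snd_le _) (norm_nonneg _) (D.scale_nonneg i)
  exact le_add_of_nonneg_left (by positivity)

theorem inner_direction (i : Fin n) (x y : ℝ) (r r' : Param k) :
    inner ℝ (D.direction i x y) (r' - r) =
      x * (D.mean i r' - D.mean i r) + y * (1 / 2 * (D.var i r' - D.var i r)) := by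
  rw [WithLp.prod_inner_apply, mean_sub, var_sub]
  change inner ℝ (x • D.a₁ i) (r' - r).fst +
    inner ℝ (y • ((1 / 2 : ℝ) • outer (D.a₂ i))) (r' - r).snd = _
  have h := real_inner_smul_left ((1 / 2 : ℝ) • outer (D.a₂ i)) (r' - r).snd y
  have h' := real_inner_smul_left (outer (D.a₂ i)) (r' - r).snd (1 / 2 : ℝ)
  have h'' := real_inner_smul_left (D.a₁ i) (r' - r).fst x
  rw [h'] at h
  exact congrArg₂ (· + ·) h'' h

/-- The gradient of the predictive expectation of example `i`. -/
def predictiveGradient (i : Fin n) (r : Param k) : Param k :=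
  D.direction i (∫ ε, D.φ' i r ε ∂(gaussianReal 0 1)) (∫ ε, D.φ'' i r ε ∂(gaussianReal 0 1))

variable {D} {M lam ζ : ℝ}

theorem predictive_eq (hD : D.BoundedBy M) (i : Fin n) {r : Param k} (hr : 0 ≤ D.var i r) :
    D.predictive i r = ∫ ε, D.φ i r ε ∂(gaussianReal 0 1) :=
  integral_gaussianReal_eq_smooth (hD.differentiable i).continuous.measurable _ hr

theorem abs_predictive_sub_le (hD : D.BoundedBy M) (hlam : 0 < lam) (i : Fin n) {r r' : Param k}
    (hr : lam ≤ D.var i r) (hr' : lam ≤ D.var i r') :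
    |D.predictive i r' - D.predictive i r| ≤
      M * (1 / √lam + 1) * D.scale i * ‖r' - r‖ := by
  rw [predictive_eq hD i (hlam.le.trans hr), predictive_eq hD i (hlam.le.trans hr')]
  have hM := hD.nonneg
  refine (abs_smooth_sub_le hlam (hD.differentiable i) (hD.bound i) (hD.bound' i) hr hr').trans ?_
  calc _ ≤ M * ((D.scale i * ‖r' - r‖) / √lam + D.scale i * ‖r' - r‖) := by
        gcongr
        · exact D.abs_var_sub_le i r r'
        · exact D.abs_mean_sub_le i r r'
    _ = _ := by ring

theorem norm_predictiveGradient_le (hD : D.BoundedBy M) (i : Fin n) (r : Param k) :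
    ‖D.predictiveGradient i r‖ ≤ D.scale i * (M + M) := by
  refine (D.norm_direction_le i _ _).trans ?_
  have := D.scale_nonneg i
  gcongr
  · exact abs_smooth_le (hD.differentiable_deriv i).continuous.measurable (hD.bound' i) _ _
  · exact abs_smooth_le (measurable_deriv _) (hD.bound'' i) _ _

/-- The mean and the variance are affine in `r`, so the estimates on the line carry over with the
factor `scale`. The second coefficient of the gradient is a smoothed derivative of a bounded
Lipschitz function, which is where Stein's identity enters. -/
theorem smoothOn_predictive (hD : D.BoundedBy M) (hlam : 0 < lam) (i : Fin n) :
    SmoothOn {r | lam ≤ D.var i r} (D.predictive i) (D.predictiveGradient i) := by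
  have hM := hD.nonneg
  have hs := D.scale_nonneg i
  have hl := Real.sqrt_pos.2 hlam
  refine ⟨2 * M * (1 / lam + 1) * D.scale i ^ 2 + D.scale i * (M * ((1 / √lam + 1) * D.scale i) +
    2 * M / √lam * ((1 / √lam + 1) * D.scale i)), by positivity, fun r hr r' hr' => ⟨?_, ?_⟩⟩
  · rw [predictive_eq hD i (hlam.le.trans hr), predictive_eq hD i (hlam.le.trans hr'),
      predictiveGradient, inner_direction]
    refine (abs_smooth_sub_sub_le hlam (hD.differentiable i) (hD.differentiable_deriv i)
      (hD.bound i) (hD.bound' i) (hD.bound'' i) hr hr').trans ?_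
    have e1 : (D.var i r' - D.var i r) ^ 2 ≤ (D.scale i * ‖r' - r‖) ^ 2 := by
      rw [← sq_abs]
      gcongr
      exact D.abs_var_sub_le i r r'
    have e2 : (D.mean i r' - D.mean i r) ^ 2 ≤ (D.scale i * ‖r' - r‖) ^ 2 := by
      rw [← sq_abs]
      gcongr
      exact D.abs_mean_sub_le i r r'
    calc _ ≤ 2 * M * ((D.scale i * ‖r' - r‖) ^ 2 / lam + (D.scale i * ‖r' - r‖) ^ 2) := by gcongr
      _ = (2 * M * (1 / lam + 1) * D.scale i ^ 2 + 0) * ‖r' - r‖ ^ 2 := by ring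
      _ ≤ _ := by
          gcongr
          positivity
  · rw [predictiveGradient, predictiveGradient, direction_sub]
    refine (D.norm_direction_le i _ _).trans ?_
    have e0 : |D.var i r' - D.var i r| / √lam + |D.mean i r' - D.mean i r| ≤
        (1 / √lam + 1) * D.scale i * ‖r' - r‖ := by
      calc _ ≤ (D.scale i * ‖r' - r‖) / √lam + D.scale i * ‖r' - r‖ := by
            gcongr
            · exact D.abs_var_sub_le i r r'
            · exact D.abs_mean_sub_le i r r'
        _ = _ := by ring
    have e1 := abs_smooth_sub_le hlam (hD.differentiable_deriv i) (hD.bound' i) (hD.bound'' i)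
      (μ := D.mean i r) (μ' := D.mean i r') hr hr'
    have e2 := abs_smooth_deriv_sub_le hlam (hD.differentiable_deriv i) (hD.bound' i)
      (hD.bound'' i) (μ := D.mean i r) (μ' := D.mean i r') hr hr'
    calc _ ≤ D.scale i * (M * ((1 / √lam + 1) * D.scale i * ‖r' - r‖) +
          2 * M / √lam * ((1 / √lam + 1) * D.scale i * ‖r' - r‖)) := by
          gcongr
          · exact e1.trans (by gcongr)
          · exact e2.trans (by gcongr)
      _ = (0 + D.scale i * (M * ((1 / √lam + 1) * D.scale i) +
            2 * M / √lam * ((1 / √lam + 1) * D.scale i))) * ‖r' - r‖ := by ring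
      _ ≤ _ := by
          gcongr
          positivity

variable (D) in
/-- The gradient of the objective on the domain. -/
def objectiveGradient (r : Param k) : Param k :=
  -(1 / (n : ℝ)) • (∑ i, (D.predictive i r)⁻¹ • D.predictiveGradient i r) +
    (D.β / n) • D.klGradient r

theorem smoothOn_kl (hK : D.K₀.PosDef) (hlam : 0 < lam) :
    SmoothOn {r | (r.V - lam • (1 : Matrix (Fin k) (Fin k) ℝ)).PosSemidef} D.kl D.klGradient :=
  ⟨_, by positivity, fun _ hr _ hr' =>
    ⟨D.abs_kl_sub_sub_le hK hlam hr hr', D.klGradient_lipschitz hlam hr hr'⟩⟩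

theorem smoothOn_objective (hD : D.BoundedBy M) (hβ : 0 ≤ D.β) (hK : D.K₀.PosDef) (hζ : 0 < ζ)
    (hlam : 0 < lam) : SmoothOn (D.domain ζ lam) D.objective D.objectiveGradient := by
  have hM := hD.nonneg
  have hl := Real.sqrt_pos.2 hlam
  refine SmoothOn.add (SmoothOn.const_mul _ (SmoothOn.sum _ fun i => ?_)) ?_
  · have hs := D.scale_nonneg i
    refine SmoothOn.log hζ ((smoothOn_predictive hD hlam i).mono fun r hr => hr.2.1 i)
      (fun r hr => hr.1 i)
      (fun r hr r' hr' => abs_predictive_sub_le hD hlam i (hr.2.1 i) (hr'.2.1 i)) (by positivity)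
      (fun r _ => norm_predictiveGradient_le hD i r)
  -- For `β = 0` the domain gives no lower bound on `V`, but the KL term is then absent.
  · rcases hβ.eq_or_lt with h0 | h0
    · simpa [← h0] using SmoothOn.zero
    · exact ((smoothOn_kl hK hlam).mono fun r hr => hr.2.2 h0).const_mul _

/-- A perturbation of the covariance of Frobenius norm below `lam / 2` changes `x ⬝ V x` by at most
`lam / 2 * |x|²`. -/
theorem posSemidef_sub_half_eventually (hlam : 0 < lam) {r : Param k}
    (hr : (r.V - lam • (1 : Matrix (Fin k) (Fin k) ℝ)).PosSemidef) :
    ∀ᶠ r' in 𝓝 r, (Param.V r' - (lam / 2) • (1 : Matrix (Fin k) (Fin k) ℝ)).PosSemidef := by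
  filter_upwards [Metric.ball_mem_nhds r (half_pos hlam)] with r' hr'
  have hT : (r'.V)ᵀ = r'.V := by
    ext i j
    exact matOf_symm r'.snd j i
  refine Matrix.PosSemidef.of_dotProduct_mulVec_nonneg ?_ fun x => ?_
  · rw [Matrix.IsHermitian, Matrix.conjTranspose_eq_transpose_of_trivial, Matrix.transpose_sub,
      hT, Matrix.transpose_smul, Matrix.transpose_one]
  · have h1 := mul_dotProduct_self_le hr x
    set X : EuclideanSpace ℝ (Fin k) := WithLp.toLp 2 x with hX
    have h2 : x ⬝ᵥ (r'.V *ᵥ x) - x ⬝ᵥ (r.V *ᵥ x) = inner ℝ (outer X) (r' - r).snd := by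
      rw [inner_outer, WithLp.sub_snd, matOf_sub, Matrix.sub_mulVec, dotProduct_sub]
      rfl
    have h3 : x ⬝ᵥ x = ‖X‖ ^ 2 := by
      rw [EuclideanSpace.real_norm_sq_eq]
      simp [dotProduct, hX, sq]
    have h4 : |inner ℝ (outer X) (r' - r).snd| ≤ ‖X‖ ^ 2 * (lam / 2) := by
      refine (abs_real_inner_le_norm _ _).trans ?_
      rw [norm_outer]
      gcongr
      refine (norm_snd_le _).trans ?_
      rw [← dist_eq_norm]
      exact (Metric.mem_ball.1 hr').le
    simp only [star_trivial, Matrix.sub_mulVec, dotProduct_sub, Matrix.smul_mulVec,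
      Matrix.one_mulVec, dotProduct_smul, smul_eq_mul]
    rw [h3] at h1 ⊢
    linarith [neg_abs_le (inner ℝ (outer X) (r' - r).snd)]

theorem continuous_mean (i : Fin n) : Continuous (D.mean i) := by
  have : LipschitzWith (D.scale i).toNNReal (D.mean i) := LipschitzWith.of_dist_le_mul fun x y => by
    rw [Real.dist_eq, dist_eq_norm, Real.coe_toNNReal _ (D.scale_nonneg i)]
    exact D.abs_mean_sub_le i y x
  exact this.continuous

theorem continuous_var (i : Fin n) : Continuous (D.var i) := by
  have : LipschitzWith (D.scale i).toNNReal (D.var i) := LipschitzWith.of_dist_le_mul fun x y => by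
    rw [Real.dist_eq, dist_eq_norm, Real.coe_toNNReal _ (D.scale_nonneg i)]
    exact D.abs_var_sub_le i y x
  exact this.continuous

/-- The domain itself need not be open. Relaxing its constants provides the neighbourhood on which
the quadratic bounds identify the true gradient. -/
theorem domain_half_mem_nhds (hD : D.BoundedBy M) (hζ : 0 < ζ) (hlam : 0 < lam) {r : Param k}
    (hr : r ∈ D.domain ζ lam) : D.domain (ζ / 2) (lam / 2) ∈ 𝓝 r := by
  have hv : ∀ᶠ r' in 𝓝 r, ∀ i, lam / 2 ≤ D.var i r' := by
    rw [eventually_all]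
    intro i
    exact (continuous_var i).continuousAt.eventually
      (le_mem_nhds ((half_lt_self hlam).trans_le (hr.2.1 i)))
  have hp : ∀ᶠ r' in 𝓝 r, ∀ i, ζ / 2 ≤ D.predictive i r' := by
    rw [eventually_all]
    intro i
    set K := M * (1 / √(lam / 2) + 1) * D.scale i
    have hc : Tendsto (fun r' => K * ‖r' - r‖) (𝓝 r) (𝓝 0) := by
      have : Continuous fun r' => K * ‖r' - r‖ := by fun_prop
      simpa using this.tendsto r
    filter_upwards [hv, hc.eventually (ge_mem_nhds (half_pos hζ))] with r' h1 h2
    have h3 := abs_predictive_sub_le hD (half_pos hlam) i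
      ((half_le_self hlam.le).trans (hr.2.1 i)) (h1 i)
    have h4 := (abs_le.1 (h3.trans h2)).1
    linarith [hr.1 i]
  have hV : ∀ᶠ r' in 𝓝 r, 0 < D.β →
      (Param.V r' - (lam / 2) • (1 : Matrix (Fin k) (Fin k) ℝ)).PosSemidef := by
    by_cases h0 : 0 < D.β
    · filter_upwards [posSemidef_sub_half_eventually hlam (hr.2.2 h0)] with r' h _
      exact h
    · exact Eventually.of_forall fun _ h => absurd h h0
  filter_upwards [hp, hv, hV] with r' h1 h2 h3
  exact ⟨h1, h2, h3⟩

theorem hasGradientAt_objective (hD : D.BoundedBy M) (hβ : 0 ≤ D.β) (hK : D.K₀.PosDef) (hζ : 0 < ζ)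
    (hlam : 0 < lam) {r : Param k} (hr : r ∈ D.domain ζ lam) :
    HasGradientAt D.objective (D.objectiveGradient r) r :=
  (smoothOn_objective hD hβ hK (half_pos hζ) (half_pos hlam)).hasGradientAt
    (domain_half_mem_nhds hD hζ hlam hr)

theorem gradient_kl (hK : D.K₀.PosDef) (hlam : 0 < lam) {r : Param k}
    (hr : (r.V - lam • (1 : Matrix (Fin k) (Fin k) ℝ)).PosSemidef) :
    ∇ D.kl r = D.klGradient r :=
  ((smoothOn_kl hK (half_pos hlam)).hasGradientAt
    (posSemidef_sub_half_eventually hlam hr)).gradient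

/-- Predictive expectations are at most `M` and the divergence is nonnegative. -/
theorem objective_lower_bound (hD : D.BoundedBy M) (hβ : 0 ≤ D.β) (hζ : 0 < ζ) (hlam : 0 < lam)
    {r : Param k} (hr : r ∈ D.domain ζ lam) :
    -(1 / (n : ℝ)) * (∑ _i : Fin n, Real.log M) ≤ D.objective r := by
  have h1 : ∑ i, Real.log (D.predictive i r) ≤ ∑ _i : Fin n, Real.log M := by
    refine Finset.sum_le_sum fun i _ => Real.log_le_log (hζ.trans_le (hr.1 i)) ?_
    rw [predictive_eq hD i (hlam.le.trans (hr.2.1 i))]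
    exact (le_abs_self _).trans
      (abs_smooth_le (hD.differentiable i).continuous.measurable (hD.bound i) _ _)
  have h2 : 0 ≤ D.β / n * D.kl r := mul_nonneg (by positivity) (D.kl_nonneg r)
  have h3 := mul_le_mul_of_nonneg_left h1 (by positivity : 0 ≤ 1 / (n : ℝ))
  unfold objective
  linarith

/-- The bMC direction as the negative gradient of the objective and the errors of the coefficients
of the examples. -/
theorem bmcDirection_add_objectiveGradient (hβ : 0 ≤ D.β) (hK : D.K₀.PosDef) (hlam : 0 < lam)
    {r : Param k} (hr : r ∈ D.domain ζ lam) (L : ℕ) (ε : Fin n → ℕ → ℝ) :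
    D.bmcDirection L ε r + D.objectiveGradient r = (1 / (n : ℝ)) •
      ∑ i, (D.exampleDirection i L (ε i) r - (D.predictive i r)⁻¹ • D.predictiveGradient i r) := by
  -- For `β = 0` the divergence may fail to be differentiable at `r`, but its coefficient vanishes.
  have h : (D.β / n) • ∇ D.kl r = (D.β / n) • D.klGradient r := by
    rcases hβ.eq_or_lt with h0 | h0
    · simp [← h0]
    · rw [gradient_kl hK hlam (hr.2.2 h0)]
  rw [bmcDirection, objectiveGradient, h, Finset.sum_sub_distrib, smul_sub, neg_smul]
  abel

end Model

/-! ### Concentration of Monte Carlo estimates -/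

section Concentration

variable {Ω : Type*} {m mΩ : MeasurableSpace Ω} {P : Measure Ω} [IsProbabilityMeasure P]

/-- The two-sided Hoeffding inequality for a sample size that ensures the confidence `κ`. -/
theorem measureReal_deviation_le {X : ℕ → Ω → ℝ} {a b c η κ : ℝ} {N : ℕ}
    (hX : ∀ l, Measurable (X l)) (hind : iIndepFun X P) (hab : ∀ l ω, X l ω ∈ Set.Icc a b)
    (hc : ∀ l, P[X l] = c) (hη : 0 < η) (hκ : 0 < κ)
    (hN : Real.log (2 / κ) / 2 * ((b - a) ^ 2 / η ^ 2) < N) :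
    P.real {ω | N * η < |∑ l ∈ Finset.range N, X l ω - N * c|} ≤ κ := by
  have hsum : ∀ ω, ∑ l ∈ Finset.range N, X l ω - N * c =
      ∑ l ∈ Finset.range N, (X l ω - c) := fun ω => by simp [Finset.sum_sub_distrib]
  simp_rw [hsum]
  obtain ⟨ω₀⟩ := P.nonempty_of_neZero
  have hab' : a ≤ b := (hab 0 ω₀).1.trans (hab 0 ω₀).2
  -- A degenerate range makes the variance proxy zero and the Hoeffding exponent meaningless; the
  -- variables are then constant and never deviate.
  rcases hab'.eq_or_lt with rfl | hlt
  · have hXa : ∀ l ω, X l ω = a := fun l ω => le_antisymm (hab l ω).2 (hab l ω).1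
    have hca : c = a := by
      rw [← hc 0]
      simp [hXa]
    have : {ω : Ω | N * η < |∑ l ∈ Finset.range N, (X l ω - c)|} = ∅ := by
      ext ω
      simp only [hXa, hca, sub_self, Finset.sum_const_zero, abs_zero, Set.mem_ofPred_eq,
        Set.mem_empty_iff_false, iff_false, not_lt]
      positivity
    rw [this, measureReal_empty]
    exact hκ.le
  rcases N.eq_zero_or_pos with rfl | hN0
  · simpa using hκ.le
  have hNpos : (0 : ℝ) < N := by exact_mod_cast hN0
  set v : ℝ≥0 := (‖b - a‖₊ / 2) ^ 2 with hv
  have hvr : (v : ℝ) = ((b - a) / 2) ^ 2 := by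
    simp [hv, abs_of_pos (sub_pos.2 hlt)]
  have hsub : ∀ l, HasSubgaussianMGF (fun ω => X l ω - c) v P := fun l => by
    have := hasSubgaussianMGF_of_mem_Icc (hX l).aemeasurable (ae_of_all P (hab l))
    rwa [hc] at this
  have hind' : iIndepFun (fun l ω => X l ω - c) P :=
    hind.comp (fun _ x => x - c) fun _ => by fun_prop
  have hindn : iIndepFun (fun l ω => -(X l ω - c)) P :=
    hind.comp (fun _ x => -(x - c)) fun _ => by fun_prop
  have hpos : 0 ≤ N * η := by positivity
  have h1 := HasSubgaussianMGF.measure_sum_range_ge_le_of_iIndepFun hind' (n := N)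
    (fun l _ => hsub l) hpos
  have h2 := HasSubgaussianMGF.measure_sum_range_ge_le_of_iIndepFun hindn (n := N)
    (fun l _ => (hsub l).neg) hpos
  -- The sample size is chosen so that each of the two one-sided tails has probability at most `κ /
  -- 2`.
  have hexp : Real.exp (-(N * η) ^ 2 / (2 * N * v)) ≤ κ / 2 := by
    rw [hvr, ← Real.le_log_iff_exp_le (by positivity)]
    have e1 : Real.log (κ / 2) = - Real.log (2 / κ) := by
      rw [← Real.log_inv, inv_div]
    have e2 : -(N * η) ^ 2 / (2 * N * ((b - a) / 2) ^ 2) = -(2 * N * (η ^ 2 / (b - a) ^ 2)) := by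
      have := (sub_pos.2 hlt).ne'
      field_simp
    have e3 : Real.log (2 / κ) ≤ 2 * N * (η ^ 2 / (b - a) ^ 2) := by
      have hba := sub_pos.2 hlt
      have e4 : Real.log (2 / κ) =
          2 * (Real.log (2 / κ) / 2 * ((b - a) ^ 2 / η ^ 2)) * (η ^ 2 / (b - a) ^ 2) := by
        field_simp
      rw [e4]
      gcongr
    rw [e1, e2]
    linarith
  calc P.real {ω | N * η < |∑ l ∈ Finset.range N, (X l ω - c)|}
      ≤ P.real ({ω | N * η ≤ ∑ l ∈ Finset.range N, (X l ω - c)} ∪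
          {ω | N * η ≤ ∑ l ∈ Finset.range N, -(X l ω - c)}) := by
        refine measureReal_mono fun ω hω => ?_
        simp only [Set.mem_ofPred_eq, lt_abs] at hω
        rcases hω with h | h
        · exact Or.inl h.le
        · refine Or.inr ?_
          simp only [Set.mem_ofPred_eq, Finset.sum_neg_distrib]
          exact h.le
    _ ≤ κ / 2 + κ / 2 := (measureReal_union_le _ _).trans
        (add_le_add (h1.trans hexp) (h2.trans hexp))
    _ = κ := by ring

/-- Bounds on the sections carry over to the joint event of independent random variables. -/
theorem measure_le_of_section_le {α β : Type*} {mα : MeasurableSpace α} {mβ : MeasurableSpace β}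
    (hm : m ≤ mΩ) {U : Ω → α} {Z : Ω → β} (hU : Measurable[m] U)
    (hZ : Measurable Z) (hind : Indep (MeasurableSpace.comap Z mβ) m P) {A : Set (α × β)}
    (hA : MeasurableSet A) {κ : ℝ≥0∞} (h : ∀ᵐ ω ∂P, P {ω' | (U ω, Z ω') ∈ A} ≤ κ) :
    P {ω | (U ω, Z ω) ∈ A} ≤ κ := by
  have hU' : Measurable U := hU.mono hm le_rfl
  have hUZ : IndepFun U Z P := by
    rw [IndepFun_iff_Indep]
    exact indep_of_indep_of_le_left hind.symm hU.comap_le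
  -- Independence makes the joint law a product, so Fubini integrates the section bounds.
  have hmap := (indepFun_iff_map_prod_eq_prod_map_map hU'.aemeasurable hZ.aemeasurable).1 hUZ
  have := Measure.isProbabilityMeasure_map (μ := P) hU'.aemeasurable
  have := Measure.isProbabilityMeasure_map (μ := P) hZ.aemeasurable
  calc P {ω | (U ω, Z ω) ∈ A} = (P.map fun ω => (U ω, Z ω)) A :=
        (Measure.map_apply (hU'.prodMk hZ) hA).symm
    _ = ∫⁻ u, (P.map Z) (Prod.mk u ⁻¹' A) ∂(P.map U) := by
        rw [hmap, Measure.prod_apply hA]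
    _ = ∫⁻ ω, (P.map Z) (Prod.mk (U ω) ⁻¹' A) ∂P :=
        lintegral_map (measurable_measure_prodMk_left hA) hU'
    _ ≤ ∫⁻ _, κ ∂P := by
        refine lintegral_mono_ae ?_
        filter_upwards [h] with ω hω
        rwa [Measure.map_apply hZ (measurable_prodMk_left hA)]
    _ = κ := by simp

theorem measurable_smooth {ψ : ℝ → ℝ} (hψ : Measurable ψ) :
    Measurable fun u : ℝ × ℝ => smooth ψ u.1 u.2 := by
  have h : StronglyMeasurable fun x : (ℝ × ℝ) × ℝ => ψ (√x.1.2 * x.2 + x.1.1) :=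
    (hψ.comp (by fun_prop)).stronglyMeasurable
  exact h.integral_prod_right.measurable

/-- The random number of summands is harmless: sizes are countable, so measurability of the sum is
checked for each fixed size. -/
theorem measurableSet_deviation {ψ : ℝ → ℝ} (hψ : Measurable ψ) {η : ℝ × ℝ → ℝ}
    (hη : Measurable η) : MeasurableSet {x : ((ℝ × ℝ) × ℕ) × (ℕ → ℝ) |
      x.1.2 * η x.1.1 < |∑ l ∈ Finset.range x.1.2, ψ (√x.1.1.2 * x.2 l + x.1.1.1) -
        x.1.2 * smooth ψ x.1.1.1 x.1.1.2|} := by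
  have hsum : Measurable fun x : ((ℝ × ℝ) × ℕ) × (ℕ → ℝ) =>
      ∑ l ∈ Finset.range x.1.2, ψ (√x.1.1.2 * x.2 l + x.1.1.1) := by
    have h : Measurable fun y : ((ℝ × ℝ) × (ℕ → ℝ)) × ℕ =>
        ∑ l ∈ Finset.range y.2, ψ (√y.1.1.2 * y.1.2 l + y.1.1.1) :=
      measurable_from_prod_countable_left fun N =>
        Finset.measurable_sum (Finset.range N) fun l _ => hψ.comp
          (by fun_prop : Measurable fun y : (ℝ × ℝ) × (ℕ → ℝ) => √y.1.2 * y.2 l + y.1.1)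
    exact h.comp (by fun_prop : Measurable fun x : ((ℝ × ℝ) × ℕ) × (ℕ → ℝ) =>
      ((x.1.1, x.2), x.1.2))
  have hN : Measurable fun x : ((ℝ × ℝ) × ℕ) × (ℕ → ℝ) => (x.1.2 : ℝ) := by fun_prop
  have hsm : Measurable fun x : ((ℝ × ℝ) × ℕ) × (ℕ → ℝ) => smooth ψ x.1.1.1 x.1.1.2 :=
    (measurable_smooth hψ).comp (by fun_prop : Measurable fun x : ((ℝ × ℝ) × ℕ) × (ℕ → ℝ) => x.1.1)
  have hηm : Measurable fun x : ((ℝ × ℝ) × ℕ) × (ℕ → ℝ) => η x.1.1 := hη.comp (by fun_prop)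
  exact measurableSet_lt (hN.mul hηm)
    (continuous_abs.measurable.comp (hsum.sub (hN.mul hsm)))

/-- Hoeffding's inequality for a Monte Carlo estimate of `smooth ψ μ v` from normal samples, where
the parameters `U = (μ, v)` and the sample size `N` depend on the past only. -/
theorem measure_sample_deviation_le (hm : m ≤ mΩ) {U : Ω → ℝ × ℝ}
    {N : Ω → ℕ} {ε : ℕ → Ω → ℝ} (hU : Measurable[m] U) (hN : Measurable[m] N)
    (hε : ∀ l, Measurable (ε l)) (hlaw : ∀ l, HasLaw (ε l) (gaussianReal 0 1) P)
    (hiid : iIndepFun ε P)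
    (hind : Indep (MeasurableSpace.comap (fun ω l => ε l ω) MeasurableSpace.pi) m P)
    {ψ : ℝ → ℝ} (hψ : Measurable ψ) {a b : ℝ} (hab : ∀ x, ψ x ∈ Set.Icc a b) {η : ℝ × ℝ → ℝ}
    (hη : Measurable η) {κ : ℝ} (hκ : 0 < κ)
    (h : ∀ᵐ ω ∂P, 0 < η (U ω) ∧
      Real.log (2 / κ) / 2 * ((b - a) ^ 2 / η (U ω) ^ 2) < N ω) :
    P {ω | N ω * η (U ω) < |∑ l ∈ Finset.range (N ω), ψ (√(U ω).2 * ε l ω + (U ω).1) -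
      N ω * smooth ψ (U ω).1 (U ω).2|} ≤ ENNReal.ofReal κ := by
  -- Freezing the parameters and the sample size leaves i.i.d. bounded terms with a deterministic
  -- size, the setting of Hoeffding's inequality.
  refine measure_le_of_section_le hm (U := fun ω => (U ω, N ω)) (Z := fun ω l => ε l ω)
    (hU.prodMk hN) (measurable_pi_lambda _ hε) hind (measurableSet_deviation hψ hη) ?_
  filter_upwards [h] with ω hω
  have hf : Measurable fun x => ψ (√(U ω).2 * x + (U ω).1) := hψ.comp (by fun_prop)
  have key := measureReal_deviation_le (P := P) (X := fun l ω' => ψ (√(U ω).2 * ε l ω' + (U ω).1))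
    (a := a) (b := b) (c := smooth ψ (U ω).1 (U ω).2) (η := η (U ω)) (κ := κ) (N := N ω)
    (fun l => hf.comp (hε l)) (hiid.comp (fun _ x => ψ (√(U ω).2 * x + (U ω).1)) fun _ => hf)
    (fun l ω' => hab _) (fun l => ?_) hω.1 hκ hω.2
  · rw [← ofReal_measureReal]
    exact ENNReal.ofReal_le_ofReal key
  · have h1 := integral_map (hε l).aemeasurable (μ := P)
      (f := fun x => ψ (√(U ω).2 * x + (U ω).1)) hf.aestronglyMeasurable
    rw [(hlaw l).map_eq] at h1
    exact h1.symm

/-- A real random variable is bounded by a constant with a probability close to one. -/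
theorem exists_measure_abs_gt_le {X : Ω → ℝ} (hX : Measurable X) {κ : ℝ≥0∞} (hκ : 0 < κ) :
    ∃ C : ℝ, 0 ≤ C ∧ P {ω | C < |X ω|} ≤ κ := by
  have hanti : Antitone fun j : ℕ => {ω | (j : ℝ) < |X ω|} := fun i j hij ω hω =>
    lt_of_le_of_lt (Nat.cast_le.2 hij : (i : ℝ) ≤ j) (Set.mem_ofPred.1 hω)
  have hmeas : ∀ j : ℕ, NullMeasurableSet {ω | (j : ℝ) < |X ω|} P := fun j =>
    (measurableSet_lt measurable_const (continuous_abs.measurable.comp hX)).nullMeasurableSet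
  have hlim := tendsto_measure_iInter_atTop hmeas hanti ⟨0, measure_ne_top P _⟩
  have hempty : ⋂ j : ℕ, {ω | (j : ℝ) < |X ω|} = ∅ := by
    ext ω
    simp only [Set.mem_iInter, Set.mem_ofPred_eq, Set.mem_empty_iff_false, iff_false, not_forall,
      not_lt]
    exact exists_nat_ge _
  rw [hempty, measure_empty] at hlim
  obtain ⟨j, hj⟩ := (hlim.eventually (ge_mem_nhds hκ)).exists
  exact ⟨j, by positivity, hj⟩

end Concentration

/-- The quotient estimate is biased, but relative accuracy `γ ≤ 1/2` keeps the denominator above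
half of its mean. Over a common denominator the difference is linear in the two deviations, hence of
order `γ`. -/
theorem abs_div_sub_div_le {s₀ s₁ e₀ e₁ N γ η ζ M : ℝ} (hN : 0 < N) (hγ : 0 ≤ γ)
    (hγ' : γ ≤ 1 / 2) (hζ : 0 < ζ) (he₀ : ζ ≤ e₀) (he₁ : |e₁| ≤ M) (hη : η ≤ M + 1)
    (h₀ : |s₀ - N * e₀| ≤ N * (γ * e₀)) (h₁ : |s₁ - N * e₁| ≤ N * (γ * η)) :
    |s₁ / s₀ - e₀⁻¹ * e₁| ≤ γ * (4 * (M + 1) / ζ) := by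
  have he : 0 < e₀ := hζ.trans_le he₀
  have hM : 0 ≤ M := (abs_nonneg _).trans he₁
  have hNe : 0 < N * e₀ := by positivity
  have hs : N * e₀ / 2 ≤ s₀ := by
    have h2 : N * (γ * e₀) ≤ N * e₀ / 2 := by nlinarith
    linarith [(abs_le.1 (h₀.trans h2)).1]
  have hs0 : 0 < s₀ := by linarith
  have e : s₁ / s₀ - e₀⁻¹ * e₁ =
      ((s₁ - N * e₁) * e₀ - e₁ * (s₀ - N * e₀)) / (s₀ * e₀) := by
    field_simp
    ring
  have hnum : |(s₁ - N * e₁) * e₀ - e₁ * (s₀ - N * e₀)| ≤ 2 * (N * γ * e₀ * (M + 1)) := by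
    refine (abs_sub _ _).trans ?_
    rw [abs_mul, abs_mul, abs_of_pos he]
    have t1 : |s₁ - N * e₁| * e₀ ≤ N * γ * e₀ * (M + 1) := by
      calc _ ≤ (N * (γ * (M + 1))) * e₀ := by
            gcongr
            exact h₁.trans (by gcongr)
        _ = _ := by ring
    have t2 : |e₁| * |s₀ - N * e₀| ≤ N * γ * e₀ * (M + 1) := by
      calc _ ≤ (M + 1) * (N * (γ * e₀)) := by
            gcongr
            linarith
        _ = _ := by ring
    linarith
  rw [e, abs_div, abs_of_pos (by positivity : 0 < s₀ * e₀)]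
  calc _ ≤ 2 * (N * γ * e₀ * (M + 1)) / (N * e₀ / 2 * ζ) := by
        gcongr
    _ = γ * (4 * (M + 1) / ζ) := by
        field_simp
        ring

namespace Model

variable {Y : Type*} {n k : ℕ} {D : Model Y n k} {M ζ lam : ℝ}

theorem absOrOne_pos (x : ℝ) : 0 < absOrOne x := by
  unfold absOrOne
  split_ifs with h
  · exact abs_pos.2 h
  · exact one_pos

theorem absOrOne_le {x : ℝ} (h : |x| ≤ M) : absOrOne x ≤ M + 1 := by
  unfold absOrOne
  split_ifs
  · linarith
  · linarith [abs_nonneg x]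

theorem measurable_absOrOne : Measurable absOrOne := by
  unfold absOrOne
  exact Measurable.ite (measurableSet_singleton (0 : ℝ)).compl continuous_abs.measurable
    measurable_const

theorem sampleFactor_nonneg (B b' B' b'' B'' : ℝ) (i : Fin n) (r : Param k) :
    0 ≤ D.sampleFactor B b' B' b'' B'' i r :=
  le_max_of_le_left (by positivity)

/-- The bound on the error of the direction from the errors of the Monte Carlo estimates. -/
theorem norm_bmcDirection_add_objectiveGradient_le (hD : D.BoundedBy M) (hβ : 0 ≤ D.β)
    (hK : D.K₀.PosDef) (hζ : 0 < ζ) (hlam : 0 < lam) {r : Param k} (hr : r ∈ D.domain ζ lam)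
    {L : ℕ} (hL : 0 < L) {ε : Fin n → ℕ → ℝ} {γ : ℝ} (hγ : 0 ≤ γ) (hγ' : γ ≤ 1 / 2)
    (h₀ : ∀ i, |∑ l ∈ Finset.range L, D.φ i r (ε i l) - L * ∫ x, D.φ i r x ∂(gaussianReal 0 1)| ≤
      L * (γ * |∫ x, D.φ i r x ∂(gaussianReal 0 1)|))
    (h₁ : ∀ i, |∑ l ∈ Finset.range L, D.φ' i r (ε i l) - L * ∫ x, D.φ' i r x ∂(gaussianReal 0 1)| ≤
      L * (γ * absOrOne (∫ x, D.φ' i r x ∂(gaussianReal 0 1))))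
    (h₂ : ∀ i, |∑ l ∈ Finset.range L, D.φ'' i r (ε i l) -
      L * ∫ x, D.φ'' i r x ∂(gaussianReal 0 1)| ≤
        L * (γ * absOrOne (∫ x, D.φ'' i r x ∂(gaussianReal 0 1)))) :
    ‖D.bmcDirection L ε r + D.objectiveGradient r‖ ≤
      γ * (1 / n * ∑ i, D.scale i * (2 * (4 * (M + 1) / ζ))) := by
  have hL' : (0 : ℝ) < L := by exact_mod_cast hL
  rw [bmcDirection_add_objectiveGradient hβ hK hlam hr, norm_smul,
    Real.norm_of_nonneg (by positivity), mul_left_comm]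
  refine mul_le_mul_of_nonneg_left ?_ (by positivity)
  rw [Finset.mul_sum]
  refine norm_sum_le_of_le _ fun i _ => ?_
  have hE := predictive_eq hD i (hlam.le.trans (hr.2.1 i))
  have hE₀ : ζ ≤ ∫ x, D.φ i r x ∂(gaussianReal 0 1) := hE ▸ hr.1 i
  have hE₁ : |∫ x, D.φ' i r x ∂(gaussianReal 0 1)| ≤ M :=
    abs_smooth_le (hD.differentiable_deriv i).continuous.measurable (hD.bound' i) _ _
  have hE₂ : |∫ x, D.φ'' i r x ∂(gaussianReal 0 1)| ≤ M :=
    abs_smooth_le (measurable_deriv _) (hD.bound'' i) _ _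
  have h₀' := h₀ i
  rw [abs_of_pos (hζ.trans_le hE₀)] at h₀'
  rw [hE, predictiveGradient, smul_direction]
  change ‖D.direction i _ _ - _‖ ≤ _
  rw [direction_sub]
  refine (D.norm_direction_le i _ _).trans ?_
  calc _ ≤ D.scale i * (γ * (4 * (M + 1) / ζ) + γ * (4 * (M + 1) / ζ)) := by
        have := D.scale_nonneg i
        gcongr
        · exact abs_div_sub_div_le hL' hγ hγ' hζ hE₀ hE₁ (absOrOne_le hE₁) h₀' (h₁ i)
        · exact abs_div_sub_div_le hL' hγ hγ' hζ hE₀ hE₂ (absOrOne_le hE₂) h₀' (h₂ i)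
    _ = _ := by ring

end Model

/-! ### Exceptional events of a single step -/

section Run

variable {Y : Type*} {n k : ℕ} {D : Model Y n k} {M ζ lam : ℝ} {Ω : Type*} {mΩ : MeasurableSpace Ω}
  {P : Measure Ω} [IsProbabilityMeasure P] {ℱ : Filtration ℕ mΩ} {γ : ℕ → ℝ} {L : ℕ → Ω → ℕ}
  {ε : ℕ → Fin n → ℕ → Ω → ℝ} {r : ℕ → Ω → Param k}

/-- The direction of step `t` of a run. -/
def runDirection (D : Model Y n k) (L : ℕ → Ω → ℕ) (ε : ℕ → Fin n → ℕ → Ω → ℝ)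
    (r : ℕ → Ω → Param k) (t : ℕ) (ω : Ω) : Param k :=
  D.bmcDirection (L t ω) (fun i l => ε t i l ω) (r t ω)

/-- The probability that one of the Monte Carlo estimates of step `t` for example `i` deviates. -/
theorem IsBMCRun.measure_deviation_le (hrun : IsBMCRun D P ℱ γ L ε r) (t : ℕ) (i : Fin n)
    {ψ : ℝ → ℝ} (hψ : Measurable ψ) {a b : ℝ} (hab : ∀ x, ψ x ∈ Set.Icc a b) {η : ℝ → ℝ}
    (hη : Measurable η) {κ : ℝ} (hκ : 0 < κ)
    (h : ∀ᵐ ω ∂P, 0 < η (smooth ψ (D.mean i (r t ω)) (D.var i (r t ω))) ∧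
      Real.log (2 / κ) / 2 * ((b - a) ^ 2 /
        η (smooth ψ (D.mean i (r t ω)) (D.var i (r t ω))) ^ 2) < L t ω) :
    P {ω | L t ω * η (smooth ψ (D.mean i (r t ω)) (D.var i (r t ω))) <
      |∑ l ∈ Finset.range (L t ω), ψ (D.g i (r t ω) (ε t i l ω)) -
        L t ω * smooth ψ (D.mean i (r t ω)) (D.var i (r t ω))|} ≤ ENNReal.ofReal κ := by
  have hU : Measurable[ℱ t] fun ω => (D.mean i (r t ω), D.var i (r t ω)) :=
    ((Model.continuous_mean i).comp_stronglyMeasurable (hrun.adapted t)).measurable.prodMk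
      ((Model.continuous_var i).comp_stronglyMeasurable (hrun.adapted t)).measurable
  exact measure_sample_deviation_le (ℱ.le t) hU (hrun.adapted_size t)
    (hrun.measurable_sample t i) (hrun.law t i) (hrun.iIndep t i) (hrun.indep_past t i) hψ hab
    (hη.comp (measurable_smooth hψ)) hκ h

/-- With a large step size the direction is bounded with high probability since it is a random
variable. -/
theorem IsBMCRun.exists_event_of_half_lt (hrun : IsBMCRun D P ℱ γ L ε r) {t : ℕ} (ht : 1 / 2 < γ t)
    {κ : ℝ≥0∞} (hκ : 0 < κ) : ∃ A : Set Ω, ∃ C : ℝ, 0 ≤ C ∧ P A ≤ κ ∧ ∀ ω ∉ A,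
      ‖runDirection D L ε r t ω + D.objectiveGradient (r t ω)‖ ≤
        γ t * (C + 2 * ‖D.objectiveGradient (r t ω)‖) := by
  have hγ : 0 < γ t := by linarith
  -- Reading the direction off two consecutive iterates gives measurability from adaptedness,
  -- without measurability of the gradient of the divergence.
  have hd : ∀ ω, ‖runDirection D L ε r t ω‖ = ‖r (t + 1) ω - r t ω‖ / γ t := by
    intro ω
    rw [hrun.step t ω, add_sub_cancel_left, norm_smul, Real.norm_of_nonneg hγ.le]
    field_simp
    rfl
  have hr : ∀ s, StronglyMeasurable fun ω => (r s ω : Param k) :=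
    fun s => (hrun.adapted s).mono (ℱ.le _)
  have hm : Measurable fun ω => ‖r (t + 1) ω - r t ω‖ / γ t :=
    ((hr (t + 1)).sub (hr t)).norm.measurable.div_const _
  obtain ⟨C, hC, hP⟩ := exists_measure_abs_gt_le (P := P) hm hκ
  -- Since `γ t > 1/2`, the doubled constants dominate `C + ‖D.objectiveGradient (r t ω)‖`.
  refine ⟨_, 2 * C, by positivity, hP, fun ω hω => ?_⟩
  simp only [Set.mem_ofPred_eq, not_lt] at hω
  have h1 : ‖runDirection D L ε r t ω‖ ≤ C := by
    rw [hd]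
    exact (le_abs_self _).trans hω
  refine (norm_add_le _ _).trans ?_
  have := norm_nonneg (D.objectiveGradient (r t ω))
  nlinarith

/-- With a small step size the sample size ensures a small error with high probability. -/
theorem IsBMCRun.exists_event_of_le_half (hrun : IsBMCRun D P ℱ γ L ε r) (hn : 0 < n)
    (hβ : 0 ≤ D.β) (hK₀ : D.K₀.PosDef) {B b' B' b'' B'' : ℝ}
    (hB : D.DerivativeBounds B b' B' b'' B'') (hD : D.BoundedBy M) (hζ : 0 < ζ) (hlam : 0 < lam)
    {t : ℕ} (hγ : 0 < γ t) (ht : γ t ≤ 1 / 2) {δ : ℝ} (hδ : 0 < δ) (hδ' : δ < 1)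
    (hdom : ∀ᵐ ω ∂P, r t ω ∈ D.domain ζ lam)
    (hL : ∀ᵐ ω ∂P, ∀ i, Real.log (6 * n / δ) / (2 * γ t ^ 2) *
      D.sampleFactor B b' B' b'' B'' i (r t ω) < L t ω) :
    ∃ A : Set Ω, P A ≤ ENNReal.ofReal δ ∧ ∀ᵐ ω ∂P, ω ∉ A →
      ‖runDirection D L ε r t ω + D.objectiveGradient (r t ω)‖ ≤
        γ t * (1 / n * ∑ i, D.scale i * (2 * (4 * (M + 1) / ζ))) := by
  have hn' : (1 : ℝ) ≤ n := by exact_mod_cast hn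
  -- Three averages for each of `n` examples share the budget `δ`, so that `2 / κ` is the `6 * n /
  -- δ` of the sample size condition. Only a union bound is used, so samples may be shared between
  -- examples.
  set κ : ℝ := δ / (3 * n) with hκ
  have hκ0 : 0 < κ := by positivity
  have hlog : Real.log (6 * n / δ) = Real.log (2 / κ) := by
    rw [hκ]
    congr 1
    field_simp
    norm_num
  have hlog0 : 0 < Real.log (6 * n / δ) := by
    refine Real.log_pos ?_
    rw [lt_div_iff₀ hδ]
    linarith
  set S : (ℝ → ℝ) → Fin n → Ω → ℝ :=
    fun ψ i ω => smooth ψ (D.mean i (r t ω)) (D.var i (r t ω)) with hS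
  set Dev : (ℝ → ℝ) → (ℝ → ℝ) → Fin n → Set Ω := fun ψ η i =>
    {ω | L t ω * η (S ψ i ω) < |∑ l ∈ Finset.range (L t ω), ψ (D.g i (r t ω) (ε t i l ω)) -
        L t ω * S ψ i ω|} with hDev
  have hscale : ∀ {x y e N : ℝ}, x ≤ y → Real.log (6 * n / δ) / (2 * γ t ^ 2) * y < N →
      x = e → Real.log (2 / κ) / 2 * (e / γ t ^ 2) < N := by
    intro x y e N hxy hy he
    subst he
    refine lt_of_le_of_lt ?_ hy
    rw [← hlog]
    calc _ = Real.log (6 * n / δ) / (2 * γ t ^ 2) * x := by ring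
      _ ≤ _ := by gcongr
  -- Tolerance `γ t` times the scale of the mean: the factor `γ t ^ 2` comes from the step size and
  -- the rest is one of the entries of `sampleFactor`.
  have hdev₀ : ∀ i, P (Dev (D.p (D.y i)) (fun x => γ t * |x|) i) ≤ ENNReal.ofReal κ := by
    intro i
    refine hrun.measure_deviation_le t i (hD.differentiable i).continuous.measurable
      (hB.bound i) (continuous_abs.measurable.const_mul _) hκ0 ?_
    filter_upwards [hdom, hL] with ω h1 h2
    have hE := Model.predictive_eq hD i (hlam.le.trans (h1.2.1 i))
    have hpos : 0 < smooth (D.p (D.y i)) (D.mean i (r t ω)) (D.var i (r t ω)) :=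
      hζ.trans_le ((h1.1 i).trans_eq hE)
    refine ⟨mul_pos hγ (abs_pos.2 hpos.ne'), ?_⟩
    rw [mul_pow, div_mul_eq_div_div_swap]
    exact hscale (le_max_left _ _) (h2 i) (by rw [sub_zero]; rfl)
  have hdev₁ : ∀ i, P (Dev (deriv (D.p (D.y i))) (fun x => γ t * Model.absOrOne x) i) ≤
      ENNReal.ofReal κ := by
    intro i
    refine hrun.measure_deviation_le t i (measurable_deriv _)
      (hB.bound' i) (Model.measurable_absOrOne.const_mul _) hκ0 ?_
    filter_upwards [hL] with ω h2
    refine ⟨mul_pos hγ (Model.absOrOne_pos _), ?_⟩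
    rw [mul_pow, div_mul_eq_div_div_swap]
    exact hscale ((le_max_left _ _).trans (le_max_right _ _)) (h2 i) rfl
  have hdev₂ : ∀ i, P (Dev (deriv (deriv (D.p (D.y i)))) (fun x => γ t * Model.absOrOne x) i) ≤
      ENNReal.ofReal κ := by
    intro i
    refine hrun.measure_deviation_le t i (measurable_deriv _)
      (hB.bound'' i) (Model.measurable_absOrOne.const_mul _) hκ0 ?_
    filter_upwards [hL] with ω h2
    refine ⟨mul_pos hγ (Model.absOrOne_pos _), ?_⟩
    rw [mul_pow, div_mul_eq_div_div_swap]
    exact hscale ((le_max_right _ _).trans (le_max_right _ _)) (h2 i) rfl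
  refine ⟨⋃ i, (Dev (D.p (D.y i)) (fun x => γ t * |x|) i ∪
    Dev (deriv (D.p (D.y i))) (fun x => γ t * Model.absOrOne x) i) ∪
    Dev (deriv (deriv (D.p (D.y i)))) (fun x => γ t * Model.absOrOne x) i, ?_, ?_⟩
  · refine (measure_iUnion_fintype_le _ _).trans ?_
    calc _ ≤ ∑ _i : Fin n, ENNReal.ofReal (3 * κ) := by
          refine Finset.sum_le_sum fun i _ => ?_
          refine (measure_union_le _ _).trans ?_
          rw [show 3 * κ = (κ + κ) + κ by ring, ENNReal.ofReal_add (by positivity) hκ0.le,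
            ENNReal.ofReal_add hκ0.le hκ0.le]
          exact add_le_add ((measure_union_le _ _).trans (add_le_add (hdev₀ i) (hdev₁ i))) (hdev₂ i)
      _ = ENNReal.ofReal δ := by
          rw [← ENNReal.ofReal_sum_of_nonneg fun _ _ => by positivity]
          congr 1
          rw [Finset.sum_const, Finset.card_univ, Fintype.card_fin, nsmul_eq_mul, hκ]
          field_simp
  · filter_upwards [hdom, hL] with ω h1 h2 hω
    simp only [Set.mem_iUnion, Set.mem_union, not_exists, not_or] at hω
    -- The logarithm is positive because `δ < 1`, so the size condition excludes an empty sample.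
    have hLpos : 0 < L t ω := by
      have h3 := h2 ⟨0, hn⟩
      have h4 := D.sampleFactor_nonneg B b' B' b'' B'' ⟨0, hn⟩ (r t ω)
      have h5 : (0 : ℝ) < L t ω := lt_of_le_of_lt (by positivity) h3
      exact_mod_cast h5
    exact Model.norm_bmcDirection_add_objectiveGradient_le hD hβ hK₀ hζ hlam h1 hLpos hγ.le ht
      (fun i => not_lt.1 (hω i).1.1) (fun i => not_lt.1 (hω i).1.2) (fun i => not_lt.1 (hω i).2)

end Run

end DLM

end

/-! ### Union bound over the steps and conclusion -/

theorem mainTheorem1 {Y : Type*} {n k : ℕ} (hn : 0 < n) (D : DLM.Model Y n k)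
    (hβ : 0 ≤ D.β) (hK₀ : D.K₀.PosDef)
    (B b' B' b'' B'' : ℝ) (hB : D.DerivativeBounds B b' B' b'' B'')
    (ζ : ℝ) (hζ : 0 < ζ) (lam : ℝ) (hlam : 0 < lam)
    (γ : ℕ → ℝ) (hγ : ∀ t, 0 < γ t)
    (hγ_sum : Tendsto (fun T => ∑ t ∈ Finset.range T, γ t) atTop atTop)
    (hγ_sq : Summable fun t => γ t ^ 2)
    (δ : ℝ) (δs : ℕ → ℝ) (hδs : ∀ t, 0 < δs t) (hδ : HasSum δs δ)
    {Ω : Type*} {mΩ : MeasurableSpace Ω} (P : Measure Ω) [IsProbabilityMeasure P]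
    (ℱ : Filtration ℕ mΩ) (L : ℕ → Ω → ℕ) (ε : ℕ → Fin n → ℕ → Ω → ℝ)
    (r : ℕ → Ω → DLM.Param k) (hrun : DLM.IsBMCRun D P ℱ γ L ε r)
    (hdom : ∀ᵐ ω ∂P, ∀ t, r t ω ∈ D.domain ζ lam)
    (hL : ∀ᵐ ω ∂P, ∀ t i, Real.log (6 * n / δs t) / (2 * γ t ^ 2) *
      D.sampleFactor B b' B' b'' B'' i (r t ω) < L t ω) :
    ∃ c₁ c₂ c₃ c₄ : ℝ, 0 < c₁ ∧ 0 < c₂ ∧ 0 < c₃ ∧ 0 < c₄ ∧ ∃ Λ : ℝ≥0,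
      ∃ G : Set Ω, MeasurableSet G ∧ 1 - δ ≤ P.real G ∧ ∀ ω ∈ G,
        DLM.GradientMethodWithErrors D.objective (D.domain ζ lam) γ (fun t => r t ω)
          (fun t => D.bmcDirection (L t ω) (fun i l => ε t i l ω) (r t ω)) c₁ c₂ c₃ c₄ Λ ∧
        (∃ l : ℝ, Tendsto (fun t => D.objective (r t ω)) atTop (𝓝 l)) ∧
        Tendsto (fun t => ∇ D.objective (r t ω)) atTop (𝓝 0) := by
  -- For `δ ≥ 1` the probability bound is void and the empty event suffices; otherwise every `δs t`
  -- is below 1.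
  rcases le_or_gt 1 δ with hδ1 | hδ1
  · exact ⟨1, 1, 1, 1, one_pos, one_pos, one_pos, one_pos, 0, ∅, MeasurableSet.empty,
      by simpa using hδ1, fun ω hω => absurd hω (Set.notMem_empty ω)⟩
  obtain ⟨M, hD⟩ := hB.exists_boundedBy
  have hM := hD.nonneg
  set C₀ : ℝ := 1 / n * ∑ i, D.scale i * (2 * (4 * (M + 1) / ζ)) with hC₀
  have hC₀' : 0 ≤ C₀ := by
    exact mul_nonneg (by positivity)
      (Finset.sum_nonneg fun i _ => mul_nonneg (D.scale_nonneg i) (by positivity))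
  -- The constant is the same `C₀` for all small steps, so only finitely many other values occur and
  -- one nonrandom bound serves all `t`.
  have hev : ∀ t, ∃ A : Set Ω, ∃ C : ℝ, (γ t ≤ 1 / 2 → C = C₀) ∧
      P A ≤ ENNReal.ofReal (δs t) ∧ ∀ᵐ ω ∂P, ω ∉ A →
        ‖DLM.runDirection D L ε r t ω + D.objectiveGradient (r t ω)‖ ≤
          γ t * (C + 2 * ‖D.objectiveGradient (r t ω)‖) := by
    intro t
    have hδt : δs t < 1 := (le_hasSum hδ t fun j _ => (hδs j).le).trans_lt hδ1
    rcases le_or_gt (γ t) (1 / 2) with ht | ht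
    · obtain ⟨A, hA, h⟩ := hrun.exists_event_of_le_half hn hβ hK₀ hB hD hζ hlam (hγ t) ht (hδs t)
        hδt (hdom.mono fun ω h => h t) (hL.mono fun ω h => h t)
      refine ⟨A, C₀, fun _ => rfl, hA, h.mono fun ω hω hωA => (hω hωA).trans ?_⟩
      refine mul_le_mul_of_nonneg_left ?_ (hγ t).le
      exact le_add_of_nonneg_right (by positivity)
    · obtain ⟨A, C, -, hA, h⟩ := hrun.exists_event_of_half_lt ht
        (ENNReal.ofReal_pos.2 (hδs t))
      exact ⟨A, C, fun h => absurd h (not_le.2 ht), hA, ae_of_all _ h⟩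
  choose A C hC hPA hA using hev
  obtain ⟨c₃, hc₃⟩ : BddAbove (Set.range C) := by
    have hγ0 : Tendsto (fun t => γ t ^ 2) atTop (𝓝 0) := hγ_sq.tendsto_atTop_zero
    refine Tendsto.bddAbove_range (a := C₀) (tendsto_const_nhds.congr' ?_)
    filter_upwards [hγ0.eventually (ge_mem_nhds (by norm_num : (0 : ℝ) < (1 / 2) ^ 2))] with t ht
    exact (hC t (le_of_sq_le_sq ht (by norm_num))).symm
  have hc₃' : ∀ t, C t ≤ |c₃| + 1 := fun t => by
    linarith [hc₃ (Set.mem_range_self t), le_abs_self c₃]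
  obtain ⟨K, hK, hsmooth⟩ := DLM.Model.smoothOn_objective hD hβ hK₀ hζ hlam
  have hgrad : ∀ x ∈ D.domain ζ lam, ∇ D.objective x = D.objectiveGradient x := fun x hx =>
    (DLM.Model.hasGradientAt_objective hD hβ hK₀ hζ hlam hx).gradient
  set bad : Set Ω := (⋃ t, A t) ∪ {ω | ¬ ((∀ t, r t ω ∈ D.domain ζ lam) ∧ ∀ t, ω ∉ A t →
    ‖DLM.runDirection D L ε r t ω + D.objectiveGradient (r t ω)‖ ≤
      γ t * (C t + 2 * ‖D.objectiveGradient (r t ω)‖))} with hbad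
  have hPbad : P bad ≤ ENNReal.ofReal δ := by
    have hnull : P {ω | ¬ ((∀ t, r t ω ∈ D.domain ζ lam) ∧ ∀ t, ω ∉ A t →
        ‖DLM.runDirection D L ε r t ω + D.objectiveGradient (r t ω)‖ ≤
          γ t * (C t + 2 * ‖D.objectiveGradient (r t ω)‖))} = 0 :=
      ae_iff.1 (hdom.and (ae_all_iff.2 hA))
    calc P bad ≤ P (⋃ t, A t) + 0 := hnull ▸ measure_union_le _ _
      _ ≤ ∑' t, ENNReal.ofReal (δs t) := by
          rw [add_zero]
          exact (measure_iUnion_le _).trans (ENNReal.tsum_le_tsum hPA)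
      _ = ENNReal.ofReal δ := by
          rw [← ENNReal.ofReal_tsum_of_nonneg (fun t => (hδs t).le) hδ.summable, hδ.tsum_eq]
  -- The constants `c₁ = c₂ = 1` reflect the choice of the exact negative gradient for `s`, and `c₄
  -- = 2` is needed for the large steps only. The bad set is not known to be measurable, so the
  -- event is the complement of its measurable hull.
  refine ⟨1, 1, |c₃| + 1, 2, one_pos, one_pos, by positivity, two_pos, K.toNNReal,
    (toMeasurable P bad)ᶜ, (measurableSet_toMeasurable P bad).compl, ?_, fun ω hω => ?_⟩
  · rw [probReal_compl_eq_one_sub (measurableSet_toMeasurable P bad)]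
    have hδ0 : 0 ≤ δ := hδ.nonneg fun t => (hδs t).le
    have h1 : P.real (toMeasurable P bad) ≤ δ := by
      rw [measureReal_def, measure_toMeasurable]
      exact ENNReal.toReal_le_of_le_ofReal hδ0 hPbad
    linarith
  · have hωb : ω ∉ bad := fun h => hω (subset_toMeasurable P bad h)
    simp only [hbad, Set.mem_union, Set.mem_iUnion, Set.mem_ofPred_eq, not_or, not_exists,
      not_not] at hωb
    obtain ⟨hωA, hωS, hωd⟩ := hωb
    have hwb : ∀ t, ‖DLM.runDirection D L ε r t ω + D.objectiveGradient (r t ω)‖ ≤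
        γ t * ((|c₃| + 1) + 2 * ‖D.objectiveGradient (r t ω)‖) := fun t => by
      refine (hωd t (hωA t)).trans ?_
      have := (hγ t).le
      gcongr
      exact hc₃' t
    have hconv := DLM.gradient_method_with_errors_convergence (h := D.objective)
      (G := D.objectiveGradient) (r := fun t => r t ω)
      (d := fun t => DLM.runDirection D L ε r t ω) (C := K) (Λ := K) (by positivity) zero_le_two
      hK hK hγ hγ_sum hγ_sq (fun t => hrun.step t ω) hwb
      (fun t => by
        have := (le_abs_self _).trans (hsmooth _ (hωS t) _ (hωS (t + 1))).1
        linarith)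
      (fun t => (hsmooth _ (hωS t) _ (hωS (t + 1))).2)
      (fun t => DLM.Model.objective_lower_bound hD hβ hζ hlam (hωS t))
    refine ⟨⟨hωS, fun t => hrun.step t ω, ?_, fun x hx =>
      (DLM.Model.hasGradientAt_objective hD hβ hK₀ hζ hlam hx).differentiableAt, ?_, hγ_sq,
      hγ_sum⟩, hconv.1, hconv.2.congr fun t => (hgrad _ (hωS t)).symm⟩
    · refine ⟨fun t => -D.objectiveGradient (r t ω),
        fun t => DLM.runDirection D L ε r t ω + D.objectiveGradient (r t ω), fun t => ?_⟩
      rw [hgrad _ (hωS t)]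
      refine ⟨?_, ?_, ?_, hwb t⟩
      · rw [neg_add_cancel_comm_assoc]
        rfl
      · rw [inner_neg_right, real_inner_self_eq_norm_sq, neg_neg, one_mul]
      · rw [norm_neg, one_mul]
    · refine LipschitzOnWith.of_dist_le_mul fun x hx y hy => ?_
      rw [hgrad x hx, hgrad y hy, dist_eq_norm, dist_eq_norm, Real.coe_toNNReal _ hK]
      exact (hsmooth y hy x hx).2
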